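/- Let $d=3$ or let $d\ge 2$ be even. Then there exist a vector field $u\in C_c^\infty(\mathbb{R}^d;\mathbb{R}^d)$ with $u\not\equiv 0$ and a function $p\in C_c^\infty(\mathbb{R}^d)$ that solve the stationary incompressible Euler equations on $\mathbb{R}^d$, $$(u\cdot\nabla)u+\nabla p=0,\qquad \operatorname{div}u=0 .$$ Moreover, if $d\ge 2$ is even, then for every even function $f\in C_c^\infty(\mathbb{R})$ the vector field $$u(x)=f(|x|)\,(x_2,-x_1,x_4,-x_3,\dots,x_d,-x_{d-1})$$ is $C^\infty$ and compactly supported on $\mathbb{R}^d$, the function $$p(x)=\int_0^{|x|} r\,f(r)^2\,dr$$ is $C^\infty$ on $\mathbb{R}^d$, the pair $(u,p)$ solves the stationary Euler equations above, and $u\not\equiv 0$ whenever $f\not\equiv 0$. -/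

import Mathlib

open scoped ContDiff

noncomputable section

/-- The divergence `∑ i, ∂ u_i / ∂ x_i` of a vector field on `ℝ^d`. -/
def divergence {d : ℕ} (u : EuclideanSpace ℝ (Fin d) → EuclideanSpace ℝ (Fin d))
    (x : EuclideanSpace ℝ (Fin d)) : ℝ :=
  ∑ i, fderiv ℝ u x (EuclideanSpace.single i 1) i

/-- The advection term `(u · ∇) u`: the `i`-th component at `x` is `∑ j, u_j ∂ u_i / ∂ x_j`, that is,
the derivative of `u` at `x` in the direction `u x`. -/
def advection {d : ℕ} (u : EuclideanSpace ℝ (Fin d) → EuclideanSpace ℝ (Fin d))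
    (x : EuclideanSpace ℝ (Fin d)) : EuclideanSpace ℝ (Fin d) :=
  fderiv ℝ u x (u x)

/-- `(u, p)` is a smooth solution of the stationary incompressible Euler equations
`(u · ∇) u + ∇ p = 0`, `div u = 0` on `ℝ^d`. -/
structure IsStationaryEuler {d : ℕ} (u : EuclideanSpace ℝ (Fin d) → EuclideanSpace ℝ (Fin d))
    (p : EuclideanSpace ℝ (Fin d) → ℝ) : Prop where
  smooth_velocity : ContDiff ℝ ∞ u
  smooth_pressure : ContDiff ℝ ∞ p
  momentum : ∀ x, advection u x + gradient p x = 0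
  div_free : ∀ x, divergence u x = 0

/-- For even `d`, the linear field `(x₂, -x₁, x₄, -x₃, …, x_d, -x_{d-1})` on `ℝ^d`
(the coordinates of `Fin d` are numbered from `0`). -/
def rotationField {d : ℕ} (hd : Even d) (x : EuclideanSpace ℝ (Fin d)) :
    EuclideanSpace ℝ (Fin d) :=
  WithLp.toLp 2 fun i : Fin d =>
    if h : Even (i : ℕ) then x ⟨(i : ℕ) + 1, by grind⟩ else -x ⟨(i : ℕ) - 1, by omega⟩

/-- The velocity field `f(|x|) (x₂, -x₁, …, x_d, -x_{d-1})`. -/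
def radialVelocity {d : ℕ} (hd : Even d) (f : ℝ → ℝ) (x : EuclideanSpace ℝ (Fin d)) :
    EuclideanSpace ℝ (Fin d) :=
  f ‖x‖ • rotationField hd x

/-- The pressure `∫₀^{|x|} r f(r)² dr`. -/
def radialPressure {d : ℕ} (f : ℝ → ℝ) (x : EuclideanSpace ℝ (Fin d)) : ℝ :=
  ∫ r in (0 : ℝ)..‖x‖, r * f r ^ 2

end

noncomputable section

open MeasureTheory Set Filter Topology

/-! In even dimension let `J` be the linear map `x ↦ (x₂, -x₁, …)`. It has zero diagonal, `J² = -1`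
and `⟨x, J x⟩ = 0`, so `f(|x|)` is constant along the flow of `u = f(|x|) J x`. Hence `div u = 0`
and `(u · ∇) u = f² J² x = -f² x`, which is minus the gradient of the radial pressure. Evenness of
`f` makes `f(|x|)` smooth at the origin (`contDiff_radial`). Beyond the support of `f` the pressure
is constant; subtracting that constant gives compact support (`exists_euler_of_even`).

In dimension three the flow is of Gavrilov type: axisymmetric, with pressure equal to its own stream
function `ψ(ρ, z)`, `ρ = r² / 2`, and `r u_r = ψ_z`, `r u_φ = F(ψ)`, `u_z = -ψ_ρ`. Such a flow is
tangent to the level sets of its pressure, so `χ(ψ) u` is again a solution, with pressure `Q(ψ)`,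
`Q' = χ²`. It therefore suffices to have a local solution around a circle enclosed by compact level
sets (`exists_compactSupport_euler`).

The ansatz is `ψ_ρ = ρ + k(ψ)`, `ψ_z² = G(ρ, ψ)` with `G = axialSq`, and `F` such that `|u|² = 3 ψ`.
The two equations for `ψ` are compatible when `G_ρ + (ρ + k) G_s = 2 k' G`. For this `G` that
reduces to the ODE system `B k' = s`, `B' = 2 s k' - 4 k / 3`, singular at `s = 0` and solved there
by a power series (`exists_levelProfile`). On the central circle `ψ_z = 0`, so `ψ_z = ±√G` is not a
smooth equation there. Instead `(ρ, ψ_z)` serve as coordinates, `z` is recovered as a potential of a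
closed form, and the map is inverted (`LevelProfile.exists_streamFunction`). Since `F` behaves like
`√ψ`, the velocity is singular on the central circle itself; the cutoff `χ` vanishes near it too. -/

/-! ### Division of the derivative of an even function by `r`. -/

/-- The weighted average `∫₀¹ tᵐ g(t r) dt`. -/
def weightedAverage (m : ℕ) (g : ℝ → ℝ) (r : ℝ) : ℝ :=
  ∫ t in (0 : ℝ)..1, t ^ m * g (t * r)

/-- Differentiation under the integral sign produces one more factor `t`. The weight `m` makes the
family closed under differentiation, so that smoothness follows by induction. -/
theorem hasDerivAt_weightedAverage (m : ℕ) {g : ℝ → ℝ} (hg : ContDiff ℝ 1 g) (r : ℝ) :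
    HasDerivAt (weightedAverage m g) (weightedAverage (m + 1) (deriv g) r) r := by
  have hg0 : Continuous g := hg.continuous
  have hg1 : Continuous (deriv g) := hg.continuous_deriv le_rfl
  obtain ⟨C, hC⟩ := (isCompact_Icc (a := -(|r| + 1)) (b := |r| + 1)).exists_bound_of_continuousOn
    hg1.continuousOn
  refine (intervalIntegral.hasDerivAt_integral_of_dominated_loc_of_deriv_le
    (bound := fun _ => C) (s := Metric.ball r 1) (Metric.ball_mem_nhds r one_pos)
    (F := fun r t => t ^ m * g (t * r)) (F' := fun r t => t ^ (m + 1) * deriv g (t * r))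
    (.of_forall fun x => ?_) ?_ ?_ (.of_forall fun t ht x hx => ?_) ?_
    (.of_forall fun t _ x _ => ?_)).2
  · exact Continuous.aestronglyMeasurable (by fun_prop)
  · exact Continuous.intervalIntegrable (by fun_prop) _ _
  · exact Continuous.aestronglyMeasurable (by fun_prop)
  · rw [uIoc_of_le zero_le_one] at ht
    have hx' : |x| ≤ |r| + 1 := by
      rw [Metric.mem_ball, Real.dist_eq] at hx
      have := abs_sub_abs_le_abs_sub x r
      linarith
    have hmem : |t * x| ≤ |r| + 1 := by
      rw [abs_mul, abs_of_pos ht.1]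
      exact (mul_le_of_le_one_left (abs_nonneg x) ht.2).trans hx'
    have h1 := hC (t * x) (by rwa [mem_Icc, ← abs_le])
    rw [norm_mul, norm_pow, Real.norm_of_nonneg ht.1.le]
    exact (mul_le_of_le_one_left (norm_nonneg _) (pow_le_one₀ ht.1.le ht.2)).trans h1
  · exact intervalIntegrable_const
  · have h1 : HasDerivAt g (deriv g (t * x)) (t * x) :=
      (hg.differentiable one_ne_zero _).hasDerivAt
    have h2 : HasDerivAt (fun x => t * x) t x := by simpa using (hasDerivAt_id x).const_mul t
    exact ((h1.comp x h2).const_mul (t ^ m)).congr_deriv (by ring)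

theorem contDiff_weightedAverage {g : ℝ → ℝ} (hg : ContDiff ℝ ∞ g) (m : ℕ) :
    ContDiff ℝ ∞ (weightedAverage m g) := by
  rw [contDiff_infty]
  intro n
  induction n generalizing m g with
  | zero =>
    exact contDiff_zero.2 (continuous_iff_continuousAt.2 fun r =>
      (hasDerivAt_weightedAverage m (hg.of_le (by exact_mod_cast le_top)) r).continuousAt)
  | succ n ih =>
    have h := hasDerivAt_weightedAverage m (hg.of_le (by exact_mod_cast le_top) : ContDiff ℝ 1 g)
    rw [Nat.cast_add, Nat.cast_one, contDiff_succ_iff_deriv]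
    refine ⟨fun r => (h r).differentiableAt, by simp, ?_⟩
    rw [show deriv (weightedAverage m g) = _ from funext fun r => (h r).deriv]
    exact ih ((contDiff_infty_iff_deriv.1 hg).2) (m + 1)

theorem deriv_neg_of_even {f : ℝ → ℝ} (hf : ∀ r, f (-r) = f r) (r : ℝ) :
    deriv f (-r) = -deriv f r := by
  have h := deriv_comp_neg f r
  simp only [hf] at h
  change deriv f r = _ at h
  linarith

/-- The derivative of an even function `f` at `r`, divided by `r` and extended smoothly to `r = 0`. -/
def derivQuotient (f : ℝ → ℝ) : ℝ → ℝ := weightedAverage 0 (deriv (deriv f))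

theorem contDiff_derivQuotient {f : ℝ → ℝ} (hf : ContDiff ℝ ∞ f) :
    ContDiff ℝ ∞ (derivQuotient f) :=
  contDiff_weightedAverage (contDiff_infty_iff_deriv.1 (contDiff_infty_iff_deriv.1 hf).2).2 0

theorem derivQuotient_neg {f : ℝ → ℝ} (he : ∀ r, f (-r) = f r) (r : ℝ) :
    derivQuotient f (-r) = derivQuotient f r := by
  have h (s : ℝ) : deriv (deriv f) (-s) = deriv (deriv f) s := by
    have h1 := deriv_comp_neg (deriv f) s
    simp only [deriv_neg_of_even he] at h1
    rw [deriv.fun_neg] at h1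
    linarith
  simp only [derivQuotient, weightedAverage, mul_neg, h]

/-- Evenness gives `f'(0) = 0`, hence `f'(r) = ∫₀^r f'' = r ∫₀¹ f''(t r) dt`. -/
theorem mul_derivQuotient {f : ℝ → ℝ} (he : ∀ r, f (-r) = f r) (hf : ContDiff ℝ ∞ f) (r : ℝ) :
    r * derivQuotient f r = deriv f r := by
  have hf1 := (contDiff_infty_iff_deriv.1 hf).2
  have h0 : deriv f 0 = 0 := by
    have := deriv_neg_of_even he 0
    rw [neg_zero] at this
    linarith
  simp only [derivQuotient, weightedAverage, pow_zero, one_mul]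
  rw [intervalIntegral.mul_integral_comp_mul_right, zero_mul, one_mul,
    intervalIntegral.integral_deriv_eq_sub, h0, sub_zero]
  · exact fun x _ => hf1.differentiable (by simp) x
  · exact (hf1.continuous_deriv (by exact_mod_cast le_top)).intervalIntegrable _ _

/-! ### Smooth even functions of the norm. -/

section Radial

variable {E : Type*} [NormedAddCommGroup E] [InnerProductSpace ℝ E]

theorem hasFDerivAt_norm_of_ne_zero {x : E} (hx : x ≠ 0) :
    HasFDerivAt (fun y : E => ‖y‖) (‖x‖⁻¹ • innerSL ℝ x) x := by
  have h := (hasStrictFDerivAt_norm_sq x).hasFDerivAt.sqrt (by simpa using hx)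
  simp only [Real.sqrt_sq (norm_nonneg _)] at h
  convert h using 1
  ext y
  simp
  field_simp

theorem hasFDerivAt_radial {f : ℝ → ℝ} (hf : ContDiff ℝ ∞ f) (he : ∀ r, f (-r) = f r) (x : E) :
    HasFDerivAt (fun y : E => f ‖y‖) (derivQuotient f ‖x‖ • innerSL ℝ x) x := by
  have hd (r : ℝ) : HasDerivAt f (r * derivQuotient f r) r := by
    rw [mul_derivQuotient he hf]
    exact (hf.differentiable (by simp) r).hasDerivAt
  rcases eq_or_ne x 0 with rfl | hx
  -- The norm is not differentiable at the origin, but `f'(0) = 0` gives `f(‖y‖) - f(0) = o(‖y‖)`.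
  · have h0 := hd 0
    rw [zero_mul, hasDerivAt_iff_isLittleO] at h0
    rw [map_zero, smul_zero, hasFDerivAt_iff_isLittleO]
    have ht : Tendsto (fun y : E => ‖y‖) (𝓝 0) (𝓝 0) := by
      simpa using (continuous_norm (E := E)).tendsto 0
    have := h0.comp_tendsto ht
    rw [← Asymptotics.isLittleO_norm_right]
    simpa [Function.comp_def] using this
  · have h := (hd ‖x‖).comp_hasFDerivAt x (hasFDerivAt_norm_of_ne_zero hx)
    refine h.congr_fderiv ?_
    have : ‖x‖ ≠ 0 := by simpa using hx
    rw [smul_smul]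
    congr 1
    field_simp

/-- The derivative is `g(|x|) ⟨x, ·⟩` with `g = f' / r` again smooth and even, so induction on the
order works when `f` is left to vary. -/
theorem contDiff_radial {f : ℝ → ℝ} (hf : ContDiff ℝ ∞ f) (he : ∀ r, f (-r) = f r) :
    ContDiff ℝ ∞ (fun x : E => f ‖x‖) := by
  rw [contDiff_infty]
  intro n
  induction n generalizing f with
  | zero =>
    exact contDiff_zero.2 (hf.continuous.comp continuous_norm)
  | succ n ih =>
    rw [Nat.cast_add, Nat.cast_one, contDiff_succ_iff_fderiv]
    refine ⟨fun x => (hasFDerivAt_radial hf he x).differentiableAt, by simp, ?_⟩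
    rw [show fderiv ℝ (fun x : E => f ‖x‖) = _ from
      funext fun x => (hasFDerivAt_radial hf he x).fderiv]
    exact (ih (contDiff_derivQuotient hf) (derivQuotient_neg he)).smul (innerSL ℝ).contDiff

end Radial

/-! ### Rotating flows in even dimension. -/

section RotationField

variable {d : ℕ}

/-- The coordinate that `rotationField` pairs with `i`. -/
def pairedIndex (hd : Even d) (i : Fin d) : Fin d :=
  if h : Even (i : ℕ) then ⟨(i : ℕ) + 1, by grind⟩ else ⟨(i : ℕ) - 1, by omega⟩

/-- The sign of the paired coordinate in `rotationField`. -/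
def pairedSign (i : Fin d) : ℝ := if Even (i : ℕ) then 1 else -1

theorem rotationField_apply (hd : Even d) (x : EuclideanSpace ℝ (Fin d)) (i : Fin d) :
    rotationField hd x i = pairedSign i * x (pairedIndex hd i) := by
  by_cases h : Even (i : ℕ) <;> simp [rotationField, pairedIndex, pairedSign, h]

theorem even_pairedIndex (hd : Even d) (i : Fin d) :
    Even (pairedIndex hd i : ℕ) ↔ ¬ Even (i : ℕ) := by
  unfold pairedIndex
  split_ifs with h
  · simp [Nat.even_add_one, h]
  · grind

theorem pairedIndex_pairedIndex (hd : Even d) (i : Fin d) :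
    pairedIndex hd (pairedIndex hd i) = i := by
  have h := even_pairedIndex hd i
  by_cases hi : Even (i : ℕ)
  · have h1 : (pairedIndex hd i : ℕ) = i + 1 := by simp [pairedIndex, hi]
    have h2 : ¬ Even (pairedIndex hd i : ℕ) := by tauto
    ext
    rw [pairedIndex, dif_neg h2]
    simp [h1]
  · have h1 : (pairedIndex hd i : ℕ) = i - 1 := by simp [pairedIndex, hi]
    have h2 : Even (pairedIndex hd i : ℕ) := by tauto
    ext
    rw [pairedIndex, dif_pos h2]
    simp [h1]
    grind

theorem pairedIndex_ne (hd : Even d) (i : Fin d) : pairedIndex hd i ≠ i := by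
  intro h
  have := even_pairedIndex hd i
  rw [h] at this
  tauto

theorem pairedSign_pairedIndex (hd : Even d) (i : Fin d) :
    pairedSign (pairedIndex hd i) = -pairedSign i := by
  have := even_pairedIndex hd i
  by_cases hi : Even (i : ℕ) <;> simp [pairedSign, this, hi]

theorem pairedSign_mul_self (i : Fin d) : pairedSign i * pairedSign i = 1 := by
  by_cases hi : Even (i : ℕ) <;> simp [pairedSign, hi]

/-- `rotationField` as a continuous linear map. -/
def rotationCLM (hd : Even d) : EuclideanSpace ℝ (Fin d) →L[ℝ] EuclideanSpace ℝ (Fin d) :=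
  LinearMap.toContinuousLinearMap
    { toFun := rotationField hd
      map_add' := fun x y => by
        ext i
        simp only [rotationField_apply, PiLp.add_apply]
        ring
      map_smul' := fun c x => by
        ext i
        simp only [rotationField_apply, PiLp.smul_apply, smul_eq_mul, RingHom.id_apply]
        ring }

theorem rotationCLM_apply (hd : Even d) (x : EuclideanSpace ℝ (Fin d)) :
    rotationCLM hd x = rotationField hd x := rfl

theorem rotationField_rotationField (hd : Even d) (x : EuclideanSpace ℝ (Fin d)) :
    rotationField hd (rotationField hd x) = -x := by
  ext i
  rw [rotationField_apply, rotationField_apply, pairedIndex_pairedIndex, pairedSign_pairedIndex,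
    PiLp.neg_apply]
  linear_combination -x i * pairedSign_mul_self i

/-- Paired indices carry the same product of coordinates with opposite signs. -/
theorem sum_mul_rotationField (hd : Even d) (x : EuclideanSpace ℝ (Fin d)) :
    ∑ i, x i * rotationField hd x i = 0 := by
  refine Finset.sum_involution (fun i _ => pairedIndex hd i) (fun i _ => ?_)
    (fun i _ _ => pairedIndex_ne hd i) (fun _ _ => Finset.mem_univ _)
    (fun i _ => pairedIndex_pairedIndex hd i)
  rw [rotationField_apply, rotationField_apply, pairedIndex_pairedIndex, pairedSign_pairedIndex]
  ring

theorem inner_rotationField (hd : Even d) (x : EuclideanSpace ℝ (Fin d)) :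
    inner ℝ x (rotationField hd x) = 0 := by
  rw [PiLp.inner_apply, ← sum_mul_rotationField hd x]
  exact Finset.sum_congr rfl fun i _ => by simp [mul_comm]

theorem rotationField_single (hd : Even d) (i : Fin d) :
    rotationField hd (EuclideanSpace.single i 1) i = 0 := by
  simp [rotationField_apply, pairedIndex_ne]

theorem hasFDerivAt_radialVelocity (hd : Even d) {f : ℝ → ℝ} (hf : ContDiff ℝ ∞ f)
    (he : ∀ r, f (-r) = f r) (x : EuclideanSpace ℝ (Fin d)) :
    HasFDerivAt (radialVelocity hd f)
      (f ‖x‖ • rotationCLM hd +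
        (derivQuotient f ‖x‖ • innerSL ℝ x).smulRight (rotationField hd x)) x :=
  (hasFDerivAt_radial hf he x).smul (rotationCLM hd).hasFDerivAt

/-- The primitive `∫₀ˢ r f(r)² dr`. -/
def momentPrimitive (f : ℝ → ℝ) (s : ℝ) : ℝ := ∫ r in (0 : ℝ)..s, r * f r ^ 2

theorem hasDerivAt_momentPrimitive {f : ℝ → ℝ} (hf : ContDiff ℝ ∞ f) (s : ℝ) :
    HasDerivAt (momentPrimitive f) (s * f s ^ 2) s :=
  have : Continuous fun r => r * f r ^ 2 := continuous_id.mul (hf.continuous.pow 2)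
  this.integral_hasStrictDerivAt 0 s |>.hasDerivAt

theorem contDiff_momentPrimitive {f : ℝ → ℝ} (hf : ContDiff ℝ ∞ f) :
    ContDiff ℝ ∞ (momentPrimitive f) := by
  rw [contDiff_infty_iff_deriv]
  refine ⟨fun s => (hasDerivAt_momentPrimitive hf s).differentiableAt, ?_⟩
  rw [show deriv (momentPrimitive f) = _ from
    funext fun s => (hasDerivAt_momentPrimitive hf s).deriv]
  exact contDiff_id.mul (hf.pow 2)

theorem momentPrimitive_neg {f : ℝ → ℝ} (he : ∀ r, f (-r) = f r) (s : ℝ) :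
    momentPrimitive f (-s) = momentPrimitive f s := by
  have h := intervalIntegral.integral_comp_neg (a := 0) (b := s) fun r => r * f r ^ 2
  simp only [he, neg_zero] at h
  rw [momentPrimitive, intervalIntegral.integral_symm, ← h, ← intervalIntegral.integral_neg]
  simp [momentPrimitive]

theorem radialPressure_eq (f : ℝ → ℝ) :
    (radialPressure f : EuclideanSpace ℝ (Fin d) → ℝ) = fun x => momentPrimitive f ‖x‖ := rfl

theorem gradient_radialPressure {f : ℝ → ℝ} (hf : ContDiff ℝ ∞ f)
    (he : ∀ r, f (-r) = f r) (x : EuclideanSpace ℝ (Fin d)) :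
    gradient (radialPressure f) x = f ‖x‖ ^ 2 • x := by
  refine HasGradientAt.gradient (hasGradientAt_iff_hasFDerivAt.2 ?_)
  have h := hasFDerivAt_radial (contDiff_momentPrimitive hf) (momentPrimitive_neg he) x
  rw [radialPressure_eq]
  refine h.congr_fderiv ?_
  rcases eq_or_ne x 0 with rfl | hx
  · simp
  have hx' : ‖x‖ ≠ 0 := by simpa using hx
  have h1 := mul_derivQuotient (momentPrimitive_neg he) (contDiff_momentPrimitive hf) ‖x‖
  rw [(hasDerivAt_momentPrimitive hf ‖x‖).deriv] at h1
  rw [mul_left_cancel₀ hx' h1]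
  ext y
  simp

theorem isStationaryEuler_radial (hd : Even d) {f : ℝ → ℝ} (hf : ContDiff ℝ ∞ f)
    (he : ∀ r, f (-r) = f r) : IsStationaryEuler (radialVelocity hd f) (radialPressure f) where
  smooth_velocity := (contDiff_radial hf he).smul (rotationCLM hd).contDiff
  smooth_pressure := contDiff_radial (contDiff_momentPrimitive hf) (momentPrimitive_neg he)
  momentum x := by
    rw [gradient_radialPressure hf he, advection, (hasFDerivAt_radialVelocity hd hf he x).fderiv]
    -- The derivative of the radial factor contributes a multiple of `⟨x, J x⟩ = 0`; what remains is
    -- `f² J² x = -f² x`.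
    simp only [add_apply, smul_apply, radialVelocity,
      ContinuousLinearMap.smulRight_apply, map_smul, rotationCLM_apply,
      rotationField_rotationField, innerSL_apply_apply, inner_rotationField]
    simp [smul_smul, sq]
  div_free x := by
    -- The linear part has zero diagonal, and the radial factor contributes a multiple of `⟨x, J
    -- x⟩`.
    rw [divergence, (hasFDerivAt_radialVelocity hd hf he x).fderiv,
      ← mul_zero (derivQuotient f ‖x‖), ← sum_mul_rotationField hd x, Finset.mul_sum]
    refine Finset.sum_congr rfl fun i _ => ?_
    simp [rotationCLM_apply, rotationField_single, mul_assoc, EuclideanSpace.inner_single_right]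

theorem hasCompactSupport_radial {f : ℝ → ℝ} (hc : HasCompactSupport f) :
    ∃ M : ℝ, ∀ r, M < r → f r = 0 := by
  obtain ⟨M, hM⟩ := hc.isCompact.isBounded.bddAbove
  exact ⟨M, fun r hr => image_eq_zero_of_notMem_tsupport fun h => (hM h).not_gt hr⟩

theorem hasCompactSupport_radialVelocity (hd : Even d) {f : ℝ → ℝ} (hc : HasCompactSupport f) :
    HasCompactSupport (radialVelocity hd f) := by
  obtain ⟨M, hM⟩ := hasCompactSupport_radial hc
  refine HasCompactSupport.intro (isCompact_closedBall (0 : EuclideanSpace ℝ (Fin d)) M) ?_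
  intro x hx
  rw [radialVelocity, hM ‖x‖ (by simpa using hx), zero_smul]

theorem radialVelocity_ne_zero (hd : Even d) (h2 : 2 ≤ d) {f : ℝ → ℝ} (hf : Continuous f)
    (he : ∀ r, f (-r) = f r) (h0 : f ≠ 0) : radialVelocity hd f ≠ 0 := by
  intro hu
  apply h0
  have hpos (r : ℝ) (hr : 0 < r) : f r = 0 := by
    set x : EuclideanSpace ℝ (Fin d) := EuclideanSpace.single ⟨0, by omega⟩ r with hx
    have hn : ‖x‖ = r := by simp [hx, abs_of_pos hr]
    have h : f r • rotationField hd x = 0 := by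
      rw [← hn]
      exact congr_fun hu x
    rcases smul_eq_zero.1 h with h | h
    · exact h
    -- `J² = -1` makes `J` injective, so `J x = 0` would force `x = 0`.
    · have h3 := rotationField_rotationField hd x
      rw [h, ← rotationCLM_apply, map_zero, zero_eq_neg] at h3
      rw [h3, norm_zero] at hn
      exact absurd hn hr.ne
  have hne (r : ℝ) (hr : r ≠ 0) : f r = 0 := by
    rcases lt_or_gt_of_ne hr with h | h
    · rw [← he]
      exact hpos _ (by linarith)
    · exact hpos r h
  have h1 : EqOn f 0 {0}ᶜ := fun r hr => hne r hr
  exact (hf.ext_on (dense_compl_singleton 0) continuous_zero h1)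

theorem exists_euler_of_even (hd : Even d) (h2 : 2 ≤ d) :
    ∃ (u : EuclideanSpace ℝ (Fin d) → EuclideanSpace ℝ (Fin d))
      (p : EuclideanSpace ℝ (Fin d) → ℝ),
      IsStationaryEuler u p ∧ HasCompactSupport u ∧ HasCompactSupport p ∧ u ≠ 0 := by
  let b : ContDiffBump (0 : ℝ) := ⟨1, 2, one_pos, one_lt_two⟩
  have hf : ContDiff ℝ ∞ b := b.contDiff
  have he (r : ℝ) : b (-r) = b r := b.neg r
  have hc : HasCompactSupport b := b.hasCompactSupport
  obtain ⟨M, hM⟩ := hasCompactSupport_radial hc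
  have hE := isStationaryEuler_radial hd hf he
  -- The subtracted constant is the value of the pressure beyond the support of `b`.
  refine ⟨radialVelocity hd b, fun x => radialPressure b x - momentPrimitive b M,
    ⟨hE.smooth_velocity, hE.smooth_pressure.sub contDiff_const, fun x => ?_, hE.div_free⟩,
    hasCompactSupport_radialVelocity hd hc, ?_, radialVelocity_ne_zero hd h2 hf.continuous he ?_⟩
  · rw [← hE.momentum x, gradient, gradient, fderiv_sub_const]
  · refine HasCompactSupport.intro (isCompact_closedBall (0 : EuclideanSpace ℝ (Fin d)) M) ?_
    intro x hx
    have hx' : M < ‖x‖ := by simpa using hx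
    have hcont : Continuous fun r => r * b r ^ 2 := continuous_id.mul (hf.continuous.pow 2)
    rw [radialPressure_eq]
    simp only [momentPrimitive]
    rw [intervalIntegral.integral_interval_sub_left (hcont.intervalIntegrable _ _)
      (hcont.intervalIntegrable _ _)]
    refine intervalIntegral.integral_zero_ae (.of_forall fun r hr => ?_)
    rw [uIoc_of_le hx'.le] at hr
    simp [hM r hr.1]
  · intro h
    have h1 : b 0 = 1 := b.one_of_mem_closedBall (by simp [b])
    rw [h] at h1
    simp at h1

end RotationField

/-! ### Power series solution of the singular profile equation. -/

/-- The multipliers `(6 n + 2) / (3 (n + 1) (n + 2))` of the recursion defining `profileCoeff`. -/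
def profileWeight (n : ℕ) : ℝ := (6 * n + 2) / (3 * (n + 1) * (n + 2))

theorem abs_profileWeight_le (n : ℕ) : |profileWeight n| ≤ 1 / 2 := by
  have hn : (0 : ℝ) ≤ n := n.cast_nonneg
  have h1 : (n : ℝ) ≤ n ^ 2 := by exact_mod_cast Nat.le_self_pow two_ne_zero n
  rw [profileWeight, abs_of_nonneg (by positivity), div_le_div_iff₀ (by positivity) two_pos]
  nlinarith

/-- Taylor coefficients of the solution `j` of `j (1 + s L j) = 1`, where `L` multiplies the `n`-th
Taylor coefficient by `profileWeight n`. -/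
def profileCoeff : ℕ → ℝ
  | 0 => 1
  | n + 1 => -∑ i : Fin n.succ, profileWeight i * profileCoeff i * profileCoeff (n - i)

theorem profileCoeff_zero : profileCoeff 0 = 1 := by rw [profileCoeff]

theorem profileCoeff_succ (n : ℕ) : profileCoeff (n + 1) =
    -∑ i : Fin n.succ, profileWeight i * profileCoeff i * profileCoeff (n - i) := by
  rw [profileCoeff]

theorem profileCoeff_succ' (n : ℕ) : profileCoeff (n + 1) =
    -∑ ij ∈ Finset.HasAntidiagonal.antidiagonal n, profileWeight ij.1 * profileCoeff ij.1 * profileCoeff ij.2 := by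
  rw [profileCoeff_succ, Finset.Nat.sum_antidiagonal_eq_sum_range_succ
    (fun x y => profileWeight x * profileCoeff x * profileCoeff y) n, Finset.sum_range]

/-- The recursion is the Catalan convolution up to sign and weights of size at most `1 / 2`, so each
step costs a factor `1 / 2`. -/
theorem abs_profileCoeff_le_catalan (n : ℕ) : |profileCoeff n| ≤ catalan n * (1 / 2) ^ n := by
  induction n using Nat.strong_induction_on with
  | _ n ih =>
    cases n with
    | zero => simp [profileCoeff_zero]
    | succ n =>
      rw [profileCoeff_succ, abs_neg, catalan_succ, Nat.cast_sum, Finset.sum_mul]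
      refine (Finset.abs_sum_le_sum_abs _ _).trans (Finset.sum_le_sum fun i _ => ?_)
      have hi := i.is_lt
      have h1 := ih i (by omega)
      have h2 := ih (n - i) (by omega)
      have h3 := abs_profileWeight_le i
      have h4 : ((1 : ℝ) / 2) ^ (n + 1) = 1 / 2 * (1 / 2) ^ (i : ℕ) * (1 / 2) ^ (n - i) := by
        rw [mul_assoc, ← pow_add, ← pow_succ']
        congr 2
        omega
      rw [abs_mul, abs_mul, h4, Nat.cast_mul]
      have h5 : |profileWeight i| * |profileCoeff i| * |profileCoeff (n - i)| ≤
          1 / 2 * (catalan i * (1 / 2) ^ (i : ℕ)) * (catalan (n - i) * (1 / 2) ^ (n - i)) := by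
        gcongr
      refine h5.trans_eq ?_
      ring

theorem abs_profileCoeff_le (n : ℕ) : |profileCoeff n| ≤ 2 ^ n := by
  have h : (catalan n : ℝ) ≤ 4 ^ n := by
    rw [catalan_eq_centralBinom_div]
    exact_mod_cast (Nat.div_le_self _ _).trans (Nat.centralBinom_le_four_pow n)
  calc |profileCoeff n| ≤ catalan n * (1 / 2) ^ n := abs_profileCoeff_le_catalan n
    _ ≤ 4 ^ n * (1 / 2) ^ n := by gcongr
    _ = 2 ^ n := by rw [← mul_pow]; norm_num

section PowerSeries

variable {a : ℕ → ℝ}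

/-- Restricting to `|s| < 1 / 4`, half of the guaranteed radius, gives a geometric majorant uniform
in `s`. -/
theorem abs_coeff_mul_pow_le (ha : ∀ n, |a n| ≤ 2 ^ n) {s : ℝ} (hs : |s| < 1 / 4) (n : ℕ) :
    ‖a n * s ^ n‖ ≤ (1 / 2) ^ n := by
  rw [norm_mul, norm_pow, Real.norm_eq_abs, Real.norm_eq_abs]
  calc _ ≤ 2 ^ n * (1 / 4 : ℝ) ^ n := by gcongr; exact ha n
    _ = _ := by rw [← mul_pow]; norm_num

theorem summable_norm_coeff (ha : ∀ n, |a n| ≤ 2 ^ n) {s : ℝ} (hs : |s| < 1 / 4) :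
    Summable fun n => ‖a n * s ^ n‖ :=
  Summable.of_nonneg_of_le (fun _ => norm_nonneg _) (abs_coeff_mul_pow_le ha hs)
    summable_geometric_two

theorem hasDerivAt_tsum_primitive (ha : ∀ n, |a n| ≤ 2 ^ n) {s : ℝ} (hs : |s| < 1 / 4) :
    HasDerivAt (fun t => ∑' n, a n / (n + 1) * t ^ (n + 1)) (∑' n, a n * s ^ n) s := by
  have hball (t : ℝ) : t ∈ Metric.ball (0 : ℝ) (1 / 4) ↔ |t| < 1 / 4 := by simp
  refine hasDerivAt_tsum_of_isPreconnected summable_geometric_two Metric.isOpen_ball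
    (convex_ball (0 : ℝ) (1 / 4)).isPreconnected (fun n t _ => ?_)
    (fun n t ht => abs_coeff_mul_pow_le ha ((hball t).1 ht) n) (y₀ := 0)
    (Metric.mem_ball_self (by norm_num)) ?_ ((hball s).2 hs)
  · refine ((hasDerivAt_pow (n + 1) t).const_mul (a n / (n + 1))).congr_deriv ?_
    have : (n : ℝ) + 1 ≠ 0 := by positivity
    push_cast
    field_simp
  · simp

theorem contDiffOn_tsum (ha : ∀ n, |a n| ≤ 2 ^ n) :
    ContDiffOn ℝ ∞ (fun t => ∑' n, a n * t ^ n) (Metric.ball 0 (1 / 4)) := by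
  let p := FormalMultilinearSeries.ofScalars ℝ a
  have hr : ((1 / 4 : NNReal) : ENNReal) ≤ p.radius := by
    refine p.le_radius_of_bound 1 fun n => ?_
    rw [FormalMultilinearSeries.ofScalars_norm]
    calc _ ≤ 2 ^ n * (1 / 4 : ℝ) ^ n := by
          gcongr
          · exact ha n
          · norm_num
      _ = (1 / 2) ^ n := by rw [← mul_pow]; norm_num
      _ ≤ 1 := pow_le_one₀ (by norm_num) (by norm_num)
  have hp := p.hasFPowerSeriesOnBall (lt_of_lt_of_le (by simp) hr)
  have h := (hp.analyticOnNhd.contDiffOn (n := ∞) (Metric.isOpen_eball.uniqueDiffOn)).mono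
    (Metric.eball_subset_eball hr)
  have he : Metric.eball (0 : ℝ) ((1 / 4 : NNReal) : ENNReal) = Metric.ball 0 (1 / 4) := by
    rw [Metric.eball_coe]
    norm_num
  rw [he] at h
  refine h.congr fun t _ => ?_
  simp [p, FormalMultilinearSeries.sum, mul_comm]

end PowerSeries

/-- A solution, near `s = 0`, of the ordinary differential equation for the level-set profile of an
axisymmetric Euler flow whose pressure is a stream function. -/
structure LevelProfile (δ : ℝ) (k j B : ℝ → ℝ) : Prop where
  contDiffOn : ContDiffOn ℝ ∞ j (Metric.ball 0 δ)
  deriv_k : ∀ s ∈ Metric.ball 0 δ, HasDerivAt k (j s) s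
  deriv_B : ∀ s ∈ Metric.ball 0 δ, HasDerivAt B (2 * s * j s - 4 / 3 * k s) s
  B_mul : ∀ s ∈ Metric.ball 0 δ, B s * j s = s
  j_pos : ∀ s ∈ Metric.ball 0 δ, 0 < j s
  k_zero : k 0 = -3 / 4
  j_zero : j 0 = 1
  swirl_pos : ∀ s ∈ Metric.ball 0 δ, 2 * k s * j s + 1 < 0

theorem exists_levelProfile : ∃ (δ : ℝ) (k j B : ℝ → ℝ), 0 < δ ∧ LevelProfile δ k j B := by
  let a := profileCoeff
  have ha : ∀ n, |a n| ≤ 2 ^ n := abs_profileCoeff_le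
  -- `b` and `q` are the coefficients of `B'` and `B / s`. The constant term of `B'` is `-(4 / 3)
  -- k(0) = 1`; its `s^(n+1)` term is `(2 - 4 / (3 (n + 1))) a n`, which is `(n + 2) * profileWeight
  -- n * a n`.
  let b : ℕ → ℝ := fun n => Nat.casesOn n 1 fun n => (n + 2) * profileWeight n * a n
  let q : ℕ → ℝ := fun n => b n / (n + 1)
  have hq0 : q 0 = 1 := by simp [q, b]
  have hq (n : ℕ) : q (n + 1) = profileWeight n * a n := by
    have : (n : ℝ) + 2 ≠ 0 := by positivity
    simp only [q, b]
    push_cast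
    rw [show (n : ℝ) + 1 + 1 = n + 2 by ring]
    field_simp
  have hb (n : ℕ) : |b n| ≤ 2 ^ n := by
    cases n with
    | zero => simp [b]
    | succ n =>
      have hn : (0 : ℝ) ≤ n := n.cast_nonneg
      have hw : |((n : ℝ) + 2) * profileWeight n| ≤ 2 := by
        rw [profileWeight, abs_of_nonneg (by positivity), ← mul_div_assoc,
          div_le_iff₀ (by positivity)]
        nlinarith
      simp only [b]
      rw [abs_mul, pow_succ']
      exact mul_le_mul hw (ha n) (abs_nonneg _) (by norm_num)
  have hqb (n : ℕ) : |q n| ≤ 2 ^ n := by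
    refine le_trans ?_ (hb n)
    simp only [q]
    rw [abs_div, abs_of_nonneg (by positivity : (0 : ℝ) ≤ (n : ℝ) + 1)]
    exact div_le_self (abs_nonneg _) (by simp)
  let j : ℝ → ℝ := fun s => ∑' n, a n * s ^ n
  let k : ℝ → ℝ := fun s => -3 / 4 + ∑' n, a n / (n + 1) * s ^ (n + 1)
  let B : ℝ → ℝ := fun s => ∑' n, b n / (n + 1) * s ^ (n + 1)
  have hmem (s : ℝ) : s ∈ Metric.ball (0 : ℝ) (1 / 4) ↔ |s| < 1 / 4 := by simp
  have hk (s : ℝ) (hs : |s| < 1 / 4) : HasDerivAt k (j s) s :=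
    (hasDerivAt_tsum_primitive ha hs).const_add _
  have hB (s : ℝ) (hs : |s| < 1 / 4) : HasDerivAt B (2 * s * j s - 4 / 3 * k s) s := by
    refine (hasDerivAt_tsum_primitive hb hs).congr_deriv ?_
    have hsa := (summable_norm_coeff ha hs).of_norm
    have hsb := (summable_norm_coeff hb hs).of_norm
    have hsk : Summable fun n : ℕ => a n / (n + 1) * s ^ (n + 1) := by
      refine Summable.of_norm_bounded (g := fun n => ‖a n * s ^ n‖) (summable_norm_coeff ha hs)
        fun n => ?_
      rw [pow_succ, norm_mul, norm_mul, norm_mul, norm_div]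
      have h1 : ‖a n‖ / ‖(n : ℝ) + 1‖ ≤ ‖a n‖ := by
        refine div_le_self (norm_nonneg _) ?_
        rw [Real.norm_of_nonneg (by positivity)]
        simp
      have h2 : ‖s‖ ≤ 1 := by rw [Real.norm_eq_abs]; linarith
      calc _ ≤ ‖a n‖ * (‖s ^ n‖ * 1) := by gcongr
        _ = _ := by ring
    rw [hsb.tsum_eq_zero_add]
    simp only [j, k]
    rw [mul_add, ← tsum_mul_left, ← tsum_mul_left, add_comm (4 / 3 * (-3 / 4 : ℝ)), ← sub_sub,
      ← (hsa.mul_left _).tsum_sub (hsk.mul_left _)]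
    have : ∀ n : ℕ, b (n + 1) * s ^ (n + 1) =
        2 * s * (a n * s ^ n) - 4 / 3 * (a n / (n + 1) * s ^ (n + 1)) := by
      intro n
      have h1 : (n : ℝ) + 1 ≠ 0 := by positivity
      have h2 : (n : ℝ) + 2 ≠ 0 := by positivity
      simp only [b, profileWeight]
      field_simp
      ring
    simp only [this]
    simp [b]
    ring
  have hBj (s : ℝ) (hs : |s| < 1 / 4) : B s * j s = s := by
    have h1 : B s = s * ∑' n, q n * s ^ n := by
      rw [← tsum_mul_left]
      exact tsum_congr fun n => by simp only [q]; ring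
    -- The Cauchy product of `B / s` and `j` is `1`: the recursion for `a` says exactly that its
    -- higher coefficients vanish.
    rw [h1, mul_assoc, tsum_mul_tsum_eq_tsum_sum_antidiagonal_of_summable_norm
      (summable_norm_coeff hqb hs) (summable_norm_coeff ha hs)]
    rw [tsum_eq_single 0]
    · simp [hq0, a, profileCoeff_zero]
    · intro n hn
      obtain ⟨n, rfl⟩ := Nat.exists_eq_succ_of_ne_zero hn
      have h2 : ∑ ij ∈ Finset.HasAntidiagonal.antidiagonal (n + 1), q ij.1 * a ij.2 = 0 := by
        rw [Finset.Nat.sum_antidiagonal_succ]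
        simp only [hq, hq0, a]
        rw [profileCoeff_succ']
        simp
      calc _ = ∑ ij ∈ Finset.HasAntidiagonal.antidiagonal (n + 1), q ij.1 * a ij.2 * s ^ (n + 1) := by
            refine Finset.sum_congr rfl fun ij hij => ?_
            rw [← Finset.HasAntidiagonal.mem_antidiagonal.1 hij]
            ring
        _ = 0 := by rw [← Finset.sum_mul, h2, zero_mul]
  have hj0 : j 0 = 1 := by
    simp only [j]
    rw [tsum_eq_single 0 fun n hn => by simp [hn]]
    simp [a, profileCoeff_zero]
  have hk0 : k 0 = -3 / 4 := by simp [k]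
  have hjs : ContDiffOn ℝ ∞ j (Metric.ball 0 (1 / 4)) := contDiffOn_tsum ha
  have hjc : ContinuousAt j 0 :=
    hjs.continuousOn.continuousAt (Metric.ball_mem_nhds 0 (by norm_num))
  have hkc : ContinuousAt k 0 := (hk 0 (by simp)).continuousAt
  have h1 : ∀ᶠ s in 𝓝 0, 0 < j s :=
    hjc.eventually (lt_mem_nhds (by rw [hj0]; norm_num))
  -- At `s = 0` the value is `2 (-3 / 4) + 1 = -1 / 2`. This sign later makes the square of the
  -- swirl positive.
  have h2 : ∀ᶠ s in 𝓝 0, 2 * k s * j s + 1 < 0 := by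
    have : ContinuousAt (fun s => 2 * k s * j s + 1) 0 := by fun_prop
    refine this.eventually (gt_mem_nhds ?_)
    simp only [hj0, hk0]
    norm_num
  obtain ⟨ε, hε, h⟩ := Metric.eventually_nhds_iff_ball.1 (h1.and h2)
  have hsub : ∀ s ∈ Metric.ball (0 : ℝ) (min ε (1 / 4)), |s| < 1 / 4 := fun s hs =>
    (hmem s).1 (Metric.ball_subset_ball (min_le_right _ _) hs)
  have hsub' : ∀ s ∈ Metric.ball (0 : ℝ) (min ε (1 / 4)), s ∈ Metric.ball (0 : ℝ) ε := fun s hs =>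
    Metric.ball_subset_ball (min_le_left _ _) hs
  exact ⟨min ε (1 / 4), k, j, B, by positivity,
    { contDiffOn := hjs.mono (Metric.ball_subset_ball (min_le_right _ _))
      deriv_k := fun s hs => hk s (hsub s hs)
      deriv_B := fun s hs => hB s (hsub s hs)
      B_mul := fun s hs => hBj s (hsub s hs)
      j_pos := fun s hs => (h s (hsub' s hs)).1
      k_zero := hk0
      j_zero := hj0
      swirl_pos := fun s hs => (h s (hsub' s hs)).2 }⟩

/-- If the derivative of `f` is a smooth function of the point and of the value of `f`, then `f` is
smooth. -/
theorem contDiffOn_of_hasFDerivAt_comp {E F : Type*} [NormedAddCommGroup E] [NormedSpace ℝ E]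
    [NormedAddCommGroup F] [NormedSpace ℝ F] {U : Set E} (hU : IsOpen U) {f : E → F}
    {A : E × F → E →L[ℝ] F} {s : Set (E × F)} (hA : ContDiffOn ℝ ∞ A s)
    (hs : ∀ x ∈ U, (x, f x) ∈ s) (hf : ∀ x ∈ U, HasFDerivAt f (A (x, f x)) x) :
    ContDiffOn ℝ ∞ f U := by
  rw [contDiffOn_infty]
  intro n
  induction n with
  | zero =>
    exact contDiffOn_zero.2 fun x hx => (hf x hx).continuousAt.continuousWithinAt
  | succ n ih =>
    rw [Nat.cast_add, Nat.cast_one, contDiffOn_succ_iff_fderiv_of_isOpen hU]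
    refine ⟨fun x hx => (hf x hx).differentiableAt.differentiableWithinAt, by simp, ?_⟩
    have h : ContDiffOn ℝ n (fun x => A (x, f x)) U :=
      (hA.of_le (by exact_mod_cast le_top)).comp (contDiffOn_id.prodMk ih) hs
    exact h.congr fun x hx => (hf x hx).fderiv

/-- The implicit function theorem for one scalar unknown. -/
theorem exists_implicit_scalar {E : Type*} [NormedAddCommGroup E] [NormedSpace ℝ E]
    [CompleteSpace E] {f : E × ℝ → ℝ} {u : E × ℝ} {L : E × ℝ →L[ℝ] ℝ} (hf : ContDiffAt ℝ 1 f u)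
    (hL : HasFDerivAt f L u) (h : L (0, 1) ≠ 0) :
    ∃ g : E → ℝ, g u.1 = u.2 ∧ ContinuousAt g u.1 ∧
      ∀ᶠ x in 𝓝 u.1, DifferentiableAt ℝ g x ∧ f (x, g x) = f u := by
  have hinv : (fderiv ℝ f u ∘SL ContinuousLinearMap.inr ℝ E ℝ).IsInvertible := by
    refine ⟨ContinuousLinearEquiv.unitsEquivAut ℝ (Units.mk0 _ h), ?_⟩
    ext
    simp [hL.fderiv]
  have hc := hf.contDiffAt_implicitFunction one_ne_zero hinv
  refine ⟨hf.implicitFunction one_ne_zero hinv, hf.implicitFunction_apply_self one_ne_zero hinv,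
    hc.continuousAt, ?_⟩
  filter_upwards [hc.eventually (by simp),
    hf.eventually_apply_implicitFunction one_ne_zero hinv] with x h1 h2
  exact ⟨h1.differentiableAt one_ne_zero, h2⟩

/-! ### The stream function in the meridian half-plane. -/

section Plane

variable {δ : ℝ} {k j B : ℝ → ℝ}

namespace LevelProfile

theorem contDiffOn_k (h : LevelProfile δ k j B) : ContDiffOn ℝ ∞ k (Metric.ball 0 δ) := by
  rw [contDiffOn_infty_iff_deriv_of_isOpen Metric.isOpen_ball]
  exact ⟨fun s hs => (h.deriv_k s hs).differentiableAt.differentiableWithinAt,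
    h.contDiffOn.congr fun s hs => (h.deriv_k s hs).deriv⟩

theorem contDiffOn_B (h : LevelProfile δ k j B) : ContDiffOn ℝ ∞ B (Metric.ball 0 δ) := by
  rw [contDiffOn_infty_iff_deriv_of_isOpen Metric.isOpen_ball]
  refine ⟨fun s hs => (h.deriv_B s hs).differentiableAt.differentiableWithinAt, ?_⟩
  have h1 : ContDiffOn ℝ ∞ (fun s => 2 * s * j s - 4 / 3 * k s) (Metric.ball 0 δ) :=
    ((contDiffOn_const.mul contDiffOn_id).mul h.contDiffOn).sub (contDiffOn_const.mul h.contDiffOn_k)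
  exact h1.congr fun s hs => (h.deriv_B s hs).deriv

theorem hasDerivAt_j (h : LevelProfile δ k j B) {s : ℝ} (hs : s ∈ Metric.ball 0 δ) :
    HasDerivAt j (deriv j s) s :=
  ((h.contDiffOn.contDiffAt (Metric.isOpen_ball.mem_nhds hs)).differentiableAt
    (by simp)).hasDerivAt

theorem deriv_j_mul (h : LevelProfile δ k j B) {s : ℝ} (hs : s ∈ Metric.ball 0 δ) :
    B s * deriv j s = 1 - (2 * s * j s - 4 / 3 * k s) * j s := by
  have h1 := (h.deriv_B s hs).mul (h.hasDerivAt_j hs)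
  have h2 : HasDerivAt (B * j) 1 s := by
    refine (hasDerivAt_id s).congr_of_eventuallyEq ?_
    filter_upwards [Metric.isOpen_ball.mem_nhds hs] with t ht
    exact h.B_mul t ht
  linarith [h1.unique h2]

end LevelProfile

/-- The square of the axial derivative of the stream function, as a function of `ρ = r² / 2` and of
the value of the stream function. -/
def axialSq (k B : ℝ → ℝ) (ρ s : ℝ) : ℝ :=
  3 * B s + 6 * s * (ρ + k s) - 2 * ρ * (ρ + k s) ^ 2

/-- The derivative of `axialSq` in its last argument. -/
def axialSqDeriv (k j : ℝ → ℝ) (ρ s : ℝ) : ℝ :=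
  2 * k s + 6 * ρ + j s * (12 * s - 4 * ρ * (ρ + k s))

/-- This is `G_ρ + (ρ + k) G_s = 2 j G`, forced by `ψ_ρ = ρ + k(ψ)`, `ψ_z² = G` and `ψ_{zρ} = j
ψ_z`. Everything cancels except a multiple of `B j - s`. -/
theorem LevelProfile.compatibility (h : LevelProfile δ k j B) (ρ : ℝ) {s : ℝ}
    (hs : s ∈ Metric.ball 0 δ) :
    6 * s - 2 * (ρ + k s) ^ 2 - 4 * ρ * (ρ + k s) + (ρ + k s) * axialSqDeriv k j ρ s =
      2 * j s * axialSq k B ρ s := by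
  have := h.B_mul s hs
  simp only [axialSq, axialSqDeriv]
  linear_combination -6 * this

section Composition

variable {E : Type*} [NormedAddCommGroup E] [NormedSpace ℝ E] {ρ σ : E → ℝ} {ρ' σ' : E →L[ℝ] ℝ}
  {x : E}

theorem LevelProfile.hasFDerivAt_axialSq (h : LevelProfile δ k j B) (hρ : HasFDerivAt ρ ρ' x)
    (hσ : HasFDerivAt σ σ' x) (hs : σ x ∈ Metric.ball 0 δ) :
    HasFDerivAt (fun y => axialSq k B (ρ y) (σ y))
      ((2 * j (σ x) * axialSq k B (ρ x) (σ x) -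
        (ρ x + k (σ x)) * axialSqDeriv k j (ρ x) (σ x)) • ρ' +
        axialSqDeriv k j (ρ x) (σ x) • σ') x := by
  have hk := (h.deriv_k _ hs).comp_hasFDerivAt x hσ
  have hB := (h.deriv_B _ hs).comp_hasFDerivAt x hσ
  have h1 := ((hB.const_mul 3).add ((hσ.const_mul 6).mul (hρ.add hk))).sub
    ((hρ.const_mul 2).mul ((hρ.add hk).pow 2))
  refine h1.congr_fderiv ?_
  rw [← h.compatibility _ hs]
  ext y
  simp [axialSqDeriv]
  ring

theorem LevelProfile.hasFDerivAt_axialSqDeriv (h : LevelProfile δ k j B)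
    (hρ : HasFDerivAt ρ ρ' x) (hσ : HasFDerivAt σ σ' x) (hs : σ x ∈ Metric.ball 0 δ) :
    HasFDerivAt (fun y => axialSqDeriv k j (ρ y) (σ y))
      ((6 - j (σ x) * (8 * ρ x + 4 * k (σ x))) • ρ' +
        (2 * j (σ x) + deriv j (σ x) * (12 * σ x - 4 * ρ x * (ρ x + k (σ x))) +
          j (σ x) * (12 - 4 * ρ x * j (σ x))) • σ') x := by
  have hk := (h.deriv_k _ hs).comp_hasFDerivAt x hσ
  have hj := (h.hasDerivAt_j hs).comp_hasFDerivAt x hσ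
  have h1 := ((hk.const_mul 2).add (hρ.const_mul 6)).add
    (hj.mul ((hσ.const_mul 12).sub ((hρ.const_mul 4).mul (hρ.add hk))))
  refine h1.congr_fderiv ?_
  ext y
  simp
  ring

end Composition

/-- The `s`-derivative of `compatibility`. It expresses equality of the mixed derivatives of `v =
ψ_z`, given `v_ρ = v j` and `v_z = G_s / 2`. -/
theorem LevelProfile.axialSqDeriv_compatibility (h : LevelProfile δ k j B) (ρ : ℝ) {s : ℝ}
    (hs : s ∈ Metric.ball 0 δ) :
    6 - j s * (8 * ρ + 4 * k s) + (2 * j s + deriv j s * (12 * s - 4 * ρ * (ρ + k s)) +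
          j s * (12 - 4 * ρ * j s)) * (ρ + k s) =
      j s * axialSqDeriv k j ρ s + 2 * axialSq k B ρ s * deriv j s := by
  have := h.deriv_j_mul hs
  simp only [axialSq, axialSqDeriv]
  linear_combination -6 * this

/-- The stream function in terms of `ρ` and of its own axial derivative. -/
theorem LevelProfile.exists_stream_of_axial (h : LevelProfile δ k j B) (hδ : 0 < δ) :
    ∃ Ψ : ℝ × ℝ → ℝ, Ψ (3 / 4, 0) = 0 ∧ ContinuousAt Ψ (3 / 4, 0) ∧ ∀ᶠ p in 𝓝 ((3 / 4, 0) : ℝ × ℝ),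
      Ψ p ∈ Metric.ball 0 δ ∧ axialSq k B p.1 (Ψ p) = p.2 ^ 2 ∧ 0 < axialSqDeriv k j p.1 (Ψ p) ∧
      HasFDerivAt Ψ
        (((p.1 + k (Ψ p)) - 2 * p.2 ^ 2 * j (Ψ p) / axialSqDeriv k j p.1 (Ψ p)) •
            ContinuousLinearMap.fst ℝ ℝ ℝ +
          (2 * p.2 / axialSqDeriv k j p.1 (Ψ p)) • ContinuousLinearMap.snd ℝ ℝ ℝ) p := by
  have h0 : (0 : ℝ) ∈ Metric.ball 0 δ := Metric.mem_ball_self hδ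
  have hB0 : B 0 = 0 := by simpa [h.j_zero] using h.B_mul 0 h0
  have hD0 : axialSqDeriv k j (3 / 4) 0 = 3 := by
    simp [axialSqDeriv, h.k_zero, h.j_zero]
    norm_num
  -- With `w = ψ_z` as a coordinate, `G(ρ, s) = w²` is solved for `s`. No square root is taken, and
  -- the slope `G_s(3 / 4, 0) = 3` is nonzero.
  let f : (ℝ × ℝ) × ℝ → ℝ := fun y => axialSq k B y.1.1 y.2 - y.1.2 ^ 2
  let u : (ℝ × ℝ) × ℝ := ((3 / 4, 0), 0)
  have hfu : f u = 0 := by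
    simp [f, u, axialSq, h.k_zero, hB0]
    norm_num
  have hf : ContDiffAt ℝ 1 f u := by
    have hn := Metric.isOpen_ball.mem_nhds h0
    have hk : ContDiffAt ℝ 1 (fun y : (ℝ × ℝ) × ℝ => k y.2) u :=
      ((h.contDiffOn_k.contDiffAt hn).of_le (by exact_mod_cast le_top)).comp u contDiffAt_snd
    have hB : ContDiffAt ℝ 1 (fun y : (ℝ × ℝ) × ℝ => B y.2) u :=
      ((h.contDiffOn_B.contDiffAt hn).of_le (by exact_mod_cast le_top)).comp u contDiffAt_snd
    have h1 := contDiffAt_fst.fst (𝕜 := ℝ) (n := 1) (x := u)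
    have h2 := contDiffAt_fst.snd (𝕜 := ℝ) (n := 1) (x := u)
    have h3 := contDiffAt_snd (𝕜 := ℝ) (n := 1) (p := u)
    exact (((contDiffAt_const.mul hB).add ((contDiffAt_const.mul h3).mul (h1.add hk))).sub
      ((contDiffAt_const.mul h1).mul ((h1.add hk).pow 2))).sub (h2.pow 2)
  have hfst : HasFDerivAt (fun y : (ℝ × ℝ) × ℝ => y.1.1)
      (ContinuousLinearMap.fst ℝ ℝ ℝ ∘L ContinuousLinearMap.fst ℝ (ℝ × ℝ) ℝ) u :=
    hasFDerivAt_fst.comp u hasFDerivAt_fst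
  have hmid : HasFDerivAt (fun y : (ℝ × ℝ) × ℝ => y.1.2)
      (ContinuousLinearMap.snd ℝ ℝ ℝ ∘L ContinuousLinearMap.fst ℝ (ℝ × ℝ) ℝ) u :=
    hasFDerivAt_snd.comp u hasFDerivAt_fst
  have hL := (h.hasFDerivAt_axialSq hfst hasFDerivAt_snd h0).sub (hmid.pow 2)
  obtain ⟨Ψ, hΨ0, hΨc, hΨ⟩ := exists_implicit_scalar hf hL (by simp [u, hD0])
  refine ⟨Ψ, hΨ0, hΨc, ?_⟩
  change ∀ᶠ p in 𝓝 ((3 / 4, 0) : ℝ × ℝ), _ ∧ f (p, Ψ p) = f u at hΨ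
  change ContinuousAt Ψ (3 / 4, 0) at hΨc
  have hball : ∀ᶠ p in 𝓝 ((3 / 4, 0) : ℝ × ℝ), Ψ p ∈ Metric.ball 0 δ := by
    refine hΨc.eventually_mem (Metric.isOpen_ball.mem_nhds ?_)
    rwa [show Ψ (3 / 4, 0) = 0 from hΨ0]
  have hDpos : ∀ᶠ p in 𝓝 ((3 / 4, 0) : ℝ × ℝ), 0 < axialSqDeriv k j p.1 (Ψ p) := by
    obtain ⟨hd, -⟩ := hΨ.self_of_nhds
    have hc := (h.hasFDerivAt_axialSqDeriv (ρ := Prod.fst) hasFDerivAt_fst hd.hasFDerivAt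
      hball.self_of_nhds).continuousAt
    refine hc.eventually (lt_mem_nhds ?_)
    change 0 < axialSqDeriv k j (3 / 4) (Ψ (3 / 4, 0))
    rw [show Ψ (3 / 4, 0) = 0 from hΨ0, hD0]
    norm_num
  filter_upwards [hball, hDpos, hΨ, hΨ.eventually_nhds] with p h1 h2 h3 h4
  have heq : axialSq k B p.1 (Ψ p) = p.2 ^ 2 := by
    have := h3.2
    rw [hfu] at this
    exact sub_eq_zero.1 this
  refine ⟨h1, heq, h2, h3.1.hasFDerivAt.congr_fderiv ?_⟩
  have h5 := (h.hasFDerivAt_axialSq (ρ := Prod.fst) hasFDerivAt_fst h3.1.hasFDerivAt h1).sub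
    ((hasFDerivAt_snd (𝕜 := ℝ) (E := ℝ) (F := ℝ) (p := p)).pow 2)
  have h6 : HasFDerivAt (fun p : ℝ × ℝ => axialSq k B p.1 (Ψ p) - p.2 ^ 2)
      (0 : ℝ × ℝ →L[ℝ] ℝ) p := by
    refine (hasFDerivAt_const (0 : ℝ) p).congr_of_eventuallyEq ?_
    filter_upwards [h4] with y hy
    rw [← hfu, ← hy.2]
  have h7 := h5.unique h6
  rw [heq] at h7
  refine ContinuousLinearMap.ext fun y => ?_
  have h8 := DFunLike.congr_fun h7 y
  simp at h8 ⊢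
  have h9 := h2.ne'
  field_simp
  linear_combination h8

/-- The axial coordinate in terms of `ρ` and of the axial derivative of the stream function. -/
theorem LevelProfile.exists_axialCoordinate (h : LevelProfile δ k j B) {Ψ : ℝ × ℝ → ℝ}
    (hΨ : ∀ᶠ p in 𝓝 ((3 / 4, 0) : ℝ × ℝ),
      Ψ p ∈ Metric.ball 0 δ ∧ axialSq k B p.1 (Ψ p) = p.2 ^ 2 ∧ 0 < axialSqDeriv k j p.1 (Ψ p) ∧
      HasFDerivAt Ψ
        (((p.1 + k (Ψ p)) - 2 * p.2 ^ 2 * j (Ψ p) / axialSqDeriv k j p.1 (Ψ p)) •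
            ContinuousLinearMap.fst ℝ ℝ ℝ +
          (2 * p.2 / axialSqDeriv k j p.1 (Ψ p)) • ContinuousLinearMap.snd ℝ ℝ ℝ) p) :
    ∃ Z : ℝ × ℝ → ℝ, Z (3 / 4, 0) = 0 ∧ ContDiffAt ℝ 1 Z (3 / 4, 0) ∧
      ∀ᶠ p in 𝓝 ((3 / 4, 0) : ℝ × ℝ), HasFDerivAt Z
        ((-(2 * p.2 * j (Ψ p)) / axialSqDeriv k j p.1 (Ψ p)) • ContinuousLinearMap.fst ℝ ℝ ℝ +
          (2 / axialSqDeriv k j p.1 (Ψ p)) • ContinuousLinearMap.snd ℝ ℝ ℝ) p := by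
  obtain ⟨ε, hε, hb⟩ := Metric.eventually_nhds_iff_ball.1 hΨ
  set c : ℝ × ℝ := (3 / 4, 0)
  -- Inverting `v_ρ = v j`, `v_z = G_s / 2` shows that `η` must be the differential of `z` as a
  -- function of `(ρ, v)`.
  let η : ℝ × ℝ → ℝ × ℝ →L[ℝ] ℝ := fun p =>
    (-(2 * p.2 * j (Ψ p)) / axialSqDeriv k j p.1 (Ψ p)) • ContinuousLinearMap.fst ℝ ℝ ℝ +
          (2 / axialSqDeriv k j p.1 (Ψ p)) • ContinuousLinearMap.snd ℝ ℝ ℝ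
  have hη : ∀ p ∈ Metric.ball c ε, ∃ η' : ℝ × ℝ →L[ℝ] ℝ × ℝ →L[ℝ] ℝ,
      HasFDerivAt η η' p ∧ ∀ x y, η' x y = η' y x := by
    intro p hp
    obtain ⟨h1, h2, h3, h4⟩ := hb p hp
    have hD := h.hasFDerivAt_axialSqDeriv (ρ := Prod.fst) hasFDerivAt_fst h4 h1
    have hj := (h.hasDerivAt_j h1).comp_hasFDerivAt p h4
    have hsnd := hasFDerivAt_snd (𝕜 := ℝ) (E := ℝ) (F := ℝ) (p := p)
    have hDi := (hasDerivAt_inv h3.ne').comp_hasFDerivAt p hD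
    have hg := ((hsnd.const_mul 2).mul hj).neg.mul hDi
    have hf := hDi.const_mul 2
    have hη' := (HasFDerivAt.smul_const (𝕜' := ℝ) hg (ContinuousLinearMap.fst ℝ ℝ ℝ)).add
      (HasFDerivAt.smul_const (𝕜' := ℝ) hf (ContinuousLinearMap.snd ℝ ℝ ℝ))
    refine ⟨_, hη'.congr_of_eventuallyEq (.of_forall fun q => ?_), fun x y => ?_⟩
    · refine ContinuousLinearMap.ext fun y => ?_
      simp [η, div_eq_mul_inv]
    · have h5 := h.axialSqDeriv_compatibility p.1 h1
      rw [h2] at h5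
      have h6 := h3.ne'
      simp
      generalize axialSqDeriv k j p.1 (Ψ p) = N at *
      field_simp
      linear_combination (x.2 * y.1 - x.1 * y.2) * N * h5
  -- Poincaré lemma: the symmetry of the derivative of `η` says that this form is closed.
  obtain ⟨Z, hZ⟩ := (convex_ball c ε).exists_forall_hasFDerivAt_of_fderiv_symmetric
    Metric.isOpen_ball 
    (fun p hp => let ⟨_, h1, _⟩ := hη p hp; h1.differentiableAt.differentiableWithinAt)
    (fun p hp x y => by
      obtain ⟨η', h1, h2⟩ := hη p hp
      rw [h1.fderiv, h2])
  have hnhds : Metric.ball c ε ∈ 𝓝 c := Metric.ball_mem_nhds c hε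
  refine ⟨fun p => Z p - Z c, sub_self _, ?_, ?_⟩
  · refine ContDiffAt.sub ?_ contDiffAt_const
    refine contDiffAt_one_iff.2 ⟨η, Metric.ball c ε, hnhds, fun p hp => ?_, hZ⟩
    obtain ⟨η', h1, -⟩ := hη p hp
    exact h1.continuousAt.continuousWithinAt
  · filter_upwards [hnhds] with p hp
    exact (hZ p hp).sub_const _

/-- A stream function `ψ (ρ, z)` with axial derivative `v`, whose level-set profile is `k, j, B`. It
has a strict minimum `0` at `(3 / 4, 0)`. -/
structure IsStreamFunction (δ : ℝ) (k j B : ℝ → ℝ) (U : Set (ℝ × ℝ)) (ψ v : ℝ × ℝ → ℝ) :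
    Prop where
  isOpen : IsOpen U
  mem : ((3 / 4, 0) : ℝ × ℝ) ∈ U
  mem_ball : ∀ p ∈ U, ψ p ∈ Metric.ball 0 δ
  rho_pos : ∀ p ∈ U, 0 < p.1
  axial_sq : ∀ p ∈ U, v p ^ 2 = axialSq k B p.1 (ψ p)
  hasFDerivAt : ∀ p ∈ U, HasFDerivAt ψ ((p.1 + k (ψ p)) • ContinuousLinearMap.fst ℝ ℝ ℝ +
    v p • ContinuousLinearMap.snd ℝ ℝ ℝ) p
  hasFDerivAt_axial : ∀ p ∈ U, HasFDerivAt v ((v p * j (ψ p)) • ContinuousLinearMap.fst ℝ ℝ ℝ +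
    (axialSqDeriv k j p.1 (ψ p) / 2) • ContinuousLinearMap.snd ℝ ℝ ℝ) p
  nonneg : ∀ p ∈ U, 0 ≤ ψ p
  eq_of_zero : ∀ p ∈ U, ψ p = 0 → p = (3 / 4, 0)
  zero : ψ (3 / 4, 0) = 0

theorem LevelProfile.exists_streamFunction (h : LevelProfile δ k j B) (hδ : 0 < δ) :
    ∃ U ψ v, IsStreamFunction δ k j B U ψ v := by
  obtain ⟨Ψ, hΨ0, hΨc, hΨ⟩ := h.exists_stream_of_axial hδ
  obtain ⟨Z, hZ0, hZc, hZ⟩ := h.exists_axialCoordinate hΨ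
  have h0 : (0 : ℝ) ∈ Metric.ball 0 δ := Metric.mem_ball_self hδ
  have hD0 : axialSqDeriv k j (3 / 4) 0 = 3 := by
    simp [axialSqDeriv, h.k_zero, h.j_zero]
    norm_num
  let u : (ℝ × ℝ) × ℝ := ((3 / 4, 0), 0)
  let π : (ℝ × ℝ) × ℝ →L[ℝ] ℝ × ℝ :=
    (ContinuousLinearMap.fst ℝ ℝ ℝ ∘L ContinuousLinearMap.fst ℝ (ℝ × ℝ) ℝ).prod
      (ContinuousLinearMap.snd ℝ (ℝ × ℝ) ℝ)
  have hπ (y : (ℝ × ℝ) × ℝ) : π y = (y.1.1, y.2) := rfl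
  -- `Z (ρ, v) = z` is solved for `v`; the slope of `Z` in `v` is `2 / 3` at the base point.
  let f : (ℝ × ℝ) × ℝ → ℝ := fun y => Z (π y) - y.1.2
  have hfu : f u = 0 := by simp [f, u, hπ, hZ0]
  have hmid : HasFDerivAt (fun y : (ℝ × ℝ) × ℝ => y.1.2)
      (ContinuousLinearMap.snd ℝ ℝ ℝ ∘L ContinuousLinearMap.fst ℝ (ℝ × ℝ) ℝ) u :=
    hasFDerivAt_snd.comp u hasFDerivAt_fst
  have hf : ContDiffAt ℝ 1 f u :=
    (ContDiffAt.comp u (g := Z) hZc π.contDiff.contDiffAt).sub (by fun_prop)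
  have hL := (HasFDerivAt.comp u (g := Z) hZ.self_of_nhds π.hasFDerivAt).sub hmid
  obtain ⟨v, hv0, hvc, hv⟩ := exists_implicit_scalar hf hL (by simp [hπ, hΨ0, hD0])
  change v (3 / 4, 0) = 0 at hv0
  change ContinuousAt v (3 / 4, 0) at hvc
  change ∀ᶠ p in 𝓝 ((3 / 4, 0) : ℝ × ℝ), _ ∧ f (p, v p) = f u at hv
  let ψ : ℝ × ℝ → ℝ := fun p => Ψ (p.1, v p)
  have hψ0 : ψ (3 / 4, 0) = 0 := by simp [ψ, hv0, hΨ0]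
  have htend : Tendsto (fun p : ℝ × ℝ => (p.1, v p)) (𝓝 (3 / 4, 0)) (𝓝 (3 / 4, 0)) := by
    have := (continuousAt_fst (p := ((3 / 4, 0) : ℝ × ℝ))).prodMk hvc
    rwa [ContinuousAt, hv0] at this
  have hψc : Tendsto ψ (𝓝 (3 / 4, 0)) (𝓝 0) := by
    have := hΨc.tendsto.comp htend
    rwa [hΨ0] at this
  have hkc : Tendsto (fun p => k (ψ p)) (𝓝 (3 / 4, 0)) (𝓝 (-3 / 4)) := by
    rw [← h.k_zero]
    exact (h.deriv_k 0 h0).continuousAt.tendsto.comp hψc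
  have hjc : Tendsto (fun p => j (ψ p)) (𝓝 (3 / 4, 0)) (𝓝 1) := by
    rw [← h.j_zero]
    exact (h.hasDerivAt_j h0).continuousAt.tendsto.comp hψc
  have hfst : Tendsto (fun p : ℝ × ℝ => p.1) (𝓝 (3 / 4, 0)) (𝓝 (3 / 4)) :=
    (continuousAt_fst (p := ((3 / 4, 0) : ℝ × ℝ))).tendsto
  have hpos : ∀ᶠ p in 𝓝 ((3 / 4, 0) : ℝ × ℝ), 0 < 1 + 2 * (p.1 + k (ψ p)) * j (ψ p) := by
    have := (((hfst.add hkc).const_mul 2).mul hjc).const_add 1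
    exact this.eventually (lt_mem_nhds (by norm_num))
  have hρ : ∀ᶠ p in 𝓝 ((3 / 4, 0) : ℝ × ℝ), 0 < p.1 :=
    hfst.eventually (lt_mem_nhds (by norm_num))
  have hall : ∀ᶠ p in 𝓝 ((3 / 4, 0) : ℝ × ℝ), ψ p ∈ Metric.ball 0 δ ∧ 0 < p.1 ∧
      v p ^ 2 = axialSq k B p.1 (ψ p) ∧
      HasFDerivAt ψ ((p.1 + k (ψ p)) • ContinuousLinearMap.fst ℝ ℝ ℝ +
        v p • ContinuousLinearMap.snd ℝ ℝ ℝ) p ∧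
      HasFDerivAt v ((v p * j (ψ p)) • ContinuousLinearMap.fst ℝ ℝ ℝ +
        (axialSqDeriv k j p.1 (ψ p) / 2) • ContinuousLinearMap.snd ℝ ℝ ℝ) p ∧
      0 ≤ ψ p ∧ (ψ p = 0 → p = (3 / 4, 0)) := by
    filter_upwards [hpos, hρ, hv, hv.eventually_nhds, htend.eventually hΨ, htend.eventually hZ]
      with p h1 h2 h3 h4 h5 h6
    obtain ⟨h7, h8, h9, h10⟩ := h5
    change ψ p ∈ _ at h7
    change axialSq k B p.1 (ψ p) = v p ^ 2 at h8
    change 0 < axialSqDeriv k j p.1 (ψ p) at h9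
    have hZp : Z (p.1, v p) = p.2 := by
      have := h3.2
      rw [hfu] at this
      exact sub_eq_zero.1 this
    have hv' : HasFDerivAt v ((v p * j (ψ p)) • ContinuousLinearMap.fst ℝ ℝ ℝ +
        (axialSqDeriv k j p.1 (ψ p) / 2) • ContinuousLinearMap.snd ℝ ℝ ℝ) p := by
      refine h3.1.hasFDerivAt.congr_fderiv ?_
      have h11 := HasFDerivAt.comp p (g := Z) h6 (hasFDerivAt_fst.prodMk h3.1.hasFDerivAt)
      have h12 : HasFDerivAt (fun p : ℝ × ℝ => Z (p.1, v p))
          (ContinuousLinearMap.snd ℝ ℝ ℝ) p := by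
        refine hasFDerivAt_snd.congr_of_eventuallyEq ?_
        filter_upwards [h4] with q hq
        have := hq.2
        rw [hfu] at this
        exact sub_eq_zero.1 this
      have h13 := h11.unique h12
      refine ContinuousLinearMap.ext fun y => ?_
      have h14 := DFunLike.congr_fun h13 y
      simp at h14 ⊢
      change _ / axialSqDeriv k j p.1 (ψ p) * _ + 2 / axialSqDeriv k j p.1 (ψ p) * _ = _ at h14
      have h15 := h9.ne'
      change -(2 * v p * j (ψ p)) / _ * _ + _ = _ at h14
      field_simp at h14 ⊢
      linear_combination h14
    have hψ' : HasFDerivAt ψ ((p.1 + k (ψ p)) • ContinuousLinearMap.fst ℝ ℝ ℝ +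
        v p • ContinuousLinearMap.snd ℝ ℝ ℝ) p := by
      refine (HasFDerivAt.comp p (g := Ψ) h10 (hasFDerivAt_fst.prodMk hv')).congr_fderiv ?_
      refine ContinuousLinearMap.ext fun y => ?_
      simp
      have h15 := h9.ne'
      change (p.1 + k (ψ p) - 2 * v p ^ 2 * j (ψ p) / axialSqDeriv k j p.1 (ψ p)) * y.1 +
        (2 * v p / axialSqDeriv k j p.1 (ψ p) * _ + 2 * v p / axialSqDeriv k j p.1 (ψ p) * _) = _
      field_simp
      ring
    have hjp := h.j_pos _ h7
    -- Multiplying `v² = G` by `j` and using `B j = s` leaves `ψ` times a factor positive near the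
    -- base point. So `ψ ≥ 0`, and `ψ = 0` forces `v = 0`, `ρ = 3 / 4` and then `z = Z (3 / 4, 0) =
    -- 0`.
    have hkey : j (ψ p) * (v p ^ 2 + 2 * p.1 * (p.1 + k (ψ p)) ^ 2) =
        3 * ψ p * (1 + 2 * (p.1 + k (ψ p)) * j (ψ p)) := by
      rw [← h8, axialSq]
      linear_combination 3 * h.B_mul _ h7
    refine ⟨h7, h2, h8.symm, hψ', hv', ?_, fun hz => ?_⟩
    · have h16 : 0 ≤ 3 * ψ p * (1 + 2 * (p.1 + k (ψ p)) * j (ψ p)) := by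
        rw [← hkey]
        positivity
      have := nonneg_of_mul_nonneg_left h16 h1
      linarith
    · rw [hz, h.k_zero, h.j_zero] at hkey
      have h16 : 0 ≤ 2 * p.1 * (p.1 + -3 / 4) ^ 2 := by positivity
      have h17 : v p = 0 := by
        have : v p ^ 2 = 0 := by nlinarith [sq_nonneg (v p)]
        simpa using this
      have h18 : p.1 = 3 / 4 := by
        have : 2 * p.1 * (p.1 + -3 / 4) ^ 2 = 0 := by nlinarith [sq_nonneg (v p)]
        have h19 : (p.1 + -3 / 4) ^ 2 = 0 := by
          rcases mul_eq_zero.1 this with h20 | h20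
          · linarith
          · exact h20
        have := pow_eq_zero_iff (two_ne_zero) |>.1 h19
        linarith
      rw [h17, h18, hZ0] at hZp
      exact Prod.ext h18 hZp.symm
  obtain ⟨U, hU, hUo, hUm⟩ := eventually_nhds_iff.1 hall
  exact ⟨U, ψ, v,
    { isOpen := hUo
      mem := hUm
      mem_ball := fun p hp => (hU p hp).1
      rho_pos := fun p hp => (hU p hp).2.1
      axial_sq := fun p hp => (hU p hp).2.2.1
      hasFDerivAt := fun p hp => (hU p hp).2.2.2.1
      hasFDerivAt_axial := fun p hp => (hU p hp).2.2.2.2.1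
      nonneg := fun p hp => (hU p hp).2.2.2.2.2.1
      eq_of_zero := fun p hp => (hU p hp).2.2.2.2.2.2
      zero := hψ0 }⟩

namespace IsStreamFunction

variable {U : Set (ℝ × ℝ)} {ψ v : ℝ × ℝ → ℝ}

/-- The implicit functions are so far only differentiable. The first-order system for the pair `(ψ,
v)` is closed with smooth right-hand side, which bootstraps regularity. -/
theorem contDiffOn_prodMk (h : LevelProfile δ k j B) (H : IsStreamFunction δ k j B U ψ v) :
    ContDiffOn ℝ ∞ (fun p => (ψ p, v p)) U := by
  let S : Set ((ℝ × ℝ) × ℝ × ℝ) := {y | y.2.1 ∈ Metric.ball 0 δ}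
  let A : (ℝ × ℝ) × ℝ × ℝ → ℝ × ℝ →L[ℝ] ℝ × ℝ := fun y =>
    ((y.1.1 + k y.2.1) • ContinuousLinearMap.fst ℝ ℝ ℝ +
      y.2.2 • ContinuousLinearMap.snd ℝ ℝ ℝ).prod
    ((y.2.2 * j y.2.1) • ContinuousLinearMap.fst ℝ ℝ ℝ +
      (axialSqDeriv k j y.1.1 y.2.1 / 2) • ContinuousLinearMap.snd ℝ ℝ ℝ)
  refine contDiffOn_of_hasFDerivAt_comp H.isOpen (A := A) (s := S) ?_ H.mem_ball
    fun p hp => (H.hasFDerivAt p hp).prodMk (H.hasFDerivAt_axial p hp)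
  have hk : ContDiffOn ℝ ∞ (fun y : (ℝ × ℝ) × ℝ × ℝ => k y.2.1) S :=
    h.contDiffOn_k.comp (by fun_prop) fun y hy => hy
  have hj : ContDiffOn ℝ ∞ (fun y : (ℝ × ℝ) × ℝ × ℝ => j y.2.1) S :=
    h.contDiffOn.comp (by fun_prop) fun y hy => hy
  have hρ : ContDiffOn ℝ ∞ (fun y : (ℝ × ℝ) × ℝ × ℝ => y.1.1) S := by fun_prop
  have hs : ContDiffOn ℝ ∞ (fun y : (ℝ × ℝ) × ℝ × ℝ => y.2.1) S := by fun_prop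
  have hv : ContDiffOn ℝ ∞ (fun y : (ℝ × ℝ) × ℝ × ℝ => y.2.2) S := by fun_prop
  have hD : ContDiffOn ℝ ∞ (fun y : (ℝ × ℝ) × ℝ × ℝ => axialSqDeriv k j y.1.1 y.2.1) S :=
    ((contDiffOn_const.mul hk).add (contDiffOn_const.mul hρ)).add
      (hj.mul ((contDiffOn_const.mul hs).sub ((contDiffOn_const.mul hρ).mul (hρ.add hk))))
  have h1 := ((hρ.add hk).smul (contDiffOn_const (c := ContinuousLinearMap.fst ℝ ℝ ℝ))).add
    (hv.smul (contDiffOn_const (c := ContinuousLinearMap.snd ℝ ℝ ℝ)))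
  have h2 := ((hv.mul hj).smul (contDiffOn_const (c := ContinuousLinearMap.fst ℝ ℝ ℝ))).add
    ((hD.div_const 2).smul (contDiffOn_const (c := ContinuousLinearMap.snd ℝ ℝ ℝ)))
  exact (ContinuousLinearMap.prodₗᵢ ℝ).toContinuousLinearEquiv.contDiff.comp_contDiffOn
    (h1.prodMk h2)

end IsStreamFunction

end Plane

/-! ### Cutting off a flow along its pressure levels. -/

section Localization

variable {d : ℕ}

theorem gradient_apply {f : EuclideanSpace ℝ (Fin d) → ℝ} (x : EuclideanSpace ℝ (Fin d))
    (i : Fin d) : gradient f x i = fderiv ℝ f x (EuclideanSpace.single i 1) := by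
  rw [← toDual_gradient, InnerProductSpace.toDual_apply_apply, EuclideanSpace.inner_single_right]
  simp

theorem gradient_congr {f g : EuclideanSpace ℝ (Fin d) → ℝ} {x : EuclideanSpace ℝ (Fin d)}
    (h : f =ᶠ[𝓝 x] g) : gradient f x = gradient g x := by
  rw [gradient, gradient, h.fderiv_eq]

/-- Multiplying a stationary Euler flow, tangent to the level sets of its own pressure, by a function
of the pressure gives again a stationary Euler flow; if a sublevel set of the pressure is compact, the
flow can thus be cut off. -/
theorem exists_compactSupport_euler {W : Set (EuclideanSpace ℝ (Fin d))} (hW : IsOpen W)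
    {u : EuclideanSpace ℝ (Fin d) → EuclideanSpace ℝ (Fin d)} {ψ : EuclideanSpace ℝ (Fin d) → ℝ}
    {ε₁ ε₂ : ℝ} (hε : ε₁ < ε₂) (hψ : ContDiffOn ℝ ∞ ψ W)
    (hu : ∀ x ∈ W, ε₁ ≤ ψ x → ContDiffAt ℝ ∞ u x)
    (hdiv : ∀ x ∈ W, ε₁ ≤ ψ x → divergence u x = 0)
    (hmom : ∀ x ∈ W, ε₁ ≤ ψ x → advection u x + gradient ψ x = 0)
    (htan : ∀ x ∈ W, ε₁ ≤ ψ x → fderiv ℝ ψ x (u x) = 0)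
    (hK : IsCompact {x ∈ W | ψ x ≤ ε₂})
    {x₀ : EuclideanSpace ℝ (Fin d)} (hx₀ : x₀ ∈ W) (hψ₀ : ψ x₀ = (ε₁ + ε₂) / 2) (hu₀ : u x₀ ≠ 0) :
    ∃ (u : EuclideanSpace ℝ (Fin d) → EuclideanSpace ℝ (Fin d))
      (p : EuclideanSpace ℝ (Fin d) → ℝ),
      IsStationaryEuler u p ∧ HasCompactSupport u ∧ HasCompactSupport p ∧ u ≠ 0 := by
  classical
  let χ : ContDiffBump ((ε₁ + ε₂) / 2 : ℝ) :=
    ⟨(ε₂ - ε₁) / 4, (ε₂ - ε₁) / 2, by linarith, by linarith⟩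
  have hχ : ContDiff ℝ ∞ χ := χ.contDiff
  have hχ_left (s : ℝ) (hs : s ≤ ε₁) : χ s = 0 := by
    refine χ.zero_of_le_dist ?_
    rw [Real.dist_eq, abs_of_nonpos (by linarith)]
    change (ε₂ - ε₁) / 2 ≤ _
    linarith
  have hχ_right (s : ℝ) (hs : ε₂ ≤ s) : χ s = 0 := by
    refine χ.zero_of_le_dist ?_
    rw [Real.dist_eq, abs_of_nonneg (by linarith)]
    change (ε₂ - ε₁) / 2 ≤ _
    linarith
  -- Advection is quadratic in the velocity, hence `Q' = χ²`. The base point `ε₂` makes the new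
  -- pressure vanish above that level.
  let Q : ℝ → ℝ := fun s => ∫ t in ε₂..s, χ t ^ 2
  have hQ (s : ℝ) : HasDerivAt Q (χ s ^ 2) s :=
    ((hχ.continuous.pow 2).integral_hasStrictDerivAt ε₂ s).hasDerivAt
  have hQs : ContDiff ℝ ∞ Q := by
    rw [contDiff_infty_iff_deriv]
    refine ⟨fun s => (hQ s).differentiableAt, ?_⟩
    rw [show deriv Q = _ from funext fun s => (hQ s).deriv]
    exact hχ.pow 2
  have hQ_right (s : ℝ) (hs : ε₂ ≤ s) : Q s = 0 := by
    refine intervalIntegral.integral_zero_ae (.of_forall fun t ht => ?_)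
    rw [uIoc_of_le hs] at ht
    simp [hχ_right t ht.1.le]
  let U : EuclideanSpace ℝ (Fin d) → EuclideanSpace ℝ (Fin d) := W.indicator fun x => χ (ψ x) • u x
  let p : EuclideanSpace ℝ (Fin d) → ℝ := W.indicator fun x => Q (ψ x)
  have hU_K (x) (hx : x ∉ {x ∈ W | ψ x ≤ ε₂}) : U x = 0 := by
    by_cases hxW : x ∈ W
    · have : ε₂ ≤ ψ x := by
        by_contra! h
        exact hx ⟨hxW, h.le⟩
      simp [U, hχ_right _ this]
    · simp [U, hxW]
  have hp_K (x) (hx : x ∉ {x ∈ W | ψ x ≤ ε₂}) : p x = 0 := by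
    by_cases hxW : x ∈ W
    · have : ε₂ ≤ ψ x := by
        by_contra! h
        exact hx ⟨hxW, h.le⟩
      simp [p, hxW, hQ_right _ this]
    · simp [p, hxW]
  have hU_W {x} (hx : x ∈ W) : U =ᶠ[𝓝 x] fun x => χ (ψ x) • u x := by
    filter_upwards [hW.mem_nhds hx] with y hy
    simp [U, hy]
  have hp_W {x} (hx : x ∈ W) : p =ᶠ[𝓝 x] fun x => Q (ψ x) := by
    filter_upwards [hW.mem_nhds hx] with y hy
    simp [p, hy]
  have hψx {x} (hx : x ∈ W) : ContDiffAt ℝ ∞ ψ x := hψ.contDiffAt (hW.mem_nhds hx)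
  have hψd {x} (hx : x ∈ W) : HasFDerivAt ψ (fderiv ℝ ψ x) x :=
    ((hψx hx).differentiableAt (by simp)).hasFDerivAt
  have hgrad {x} (hx : x ∈ W) : gradient p x = χ (ψ x) ^ 2 • gradient ψ x := by
    ext i
    rw [gradient_congr (hp_W hx), gradient_apply, PiLp.smul_apply, gradient_apply]
    exact DFunLike.congr_fun ((hQ (ψ x)).comp_hasFDerivAt x (hψd hx)).fderiv _
  have htriv {x} (hUx : U =ᶠ[𝓝 x] fun _ => 0) :
      ContDiffAt ℝ ∞ U x ∧ advection U x = 0 ∧ divergence U x = 0 := by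
    refine ⟨contDiffAt_const.congr_of_eventuallyEq hUx, ?_, ?_⟩
    · simp [advection, hUx.fderiv_eq]
    · simp [divergence, hUx.fderiv_eq]
  have hall (x) : ContDiffAt ℝ ∞ U x ∧ ContDiffAt ℝ ∞ p x ∧
      advection U x + gradient p x = 0 ∧ divergence U x = 0 := by
    by_cases hx : x ∈ W
    · have hps : ContDiffAt ℝ ∞ p x :=
        (hQs.contDiffAt.comp x (hψx hx)).congr_of_eventuallyEq (hp_W hx)
      rcases lt_or_ge (ψ x) ε₁ with hlt | hge
      -- Below the level `ε₁` nothing is assumed about `u`; the cutoff vanishes there.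
      · have hUx : U =ᶠ[𝓝 x] fun _ => 0 := by
          filter_upwards [hU_W hx, (hψx hx).continuousAt.eventually (gt_mem_nhds hlt)] with y h1 h2
          rw [h1, hχ_left _ h2.le, zero_smul]
        obtain ⟨h1, h2, h3⟩ := htriv hUx
        refine ⟨h1, hps, ?_, h3⟩
        rw [h2, hgrad hx, hχ_left _ hlt.le]
        simp
      · have hux := hu x hx hge
        have hud := (hux.differentiableAt (by simp)).hasFDerivAt
        have hχd := ((hχ.differentiable (by simp) (ψ x)).hasDerivAt).comp_hasFDerivAt x (hψd hx)
        have hUd : fderiv ℝ U x = χ (ψ x) • fderiv ℝ u x +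
            (deriv χ (ψ x) • fderiv ℝ ψ x).smulRight (u x) := by
          rw [(hU_W hx).fderiv_eq]
          exact (hχd.smul hud).fderiv
        refine ⟨((hχ.contDiffAt.comp x (hψx hx)).smul hux).congr_of_eventuallyEq (hU_W hx), hps,
          ?_, ?_⟩
        -- Tangency `u · ∇ψ = 0` removes the term with the derivative of `χ`.
        · have hadv : advection U x = χ (ψ x) ^ 2 • advection u x := by
            rw [advection, hUd, (hU_W hx).self_of_nhds]
            simp [htan x hx hge, advection, smul_smul, sq]
          rw [hadv, hgrad hx, ← smul_add, hmom x hx hge, smul_zero]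
        · have h1 : fderiv ℝ ψ x (u x) = ∑ i, fderiv ℝ ψ x (EuclideanSpace.single i 1) * u x i := by
            conv_lhs => rw [← (EuclideanSpace.basisFun (Fin d) ℝ).sum_repr (u x)]
            simp [mul_comm]
          have h2 : divergence U x = χ (ψ x) * divergence u x +
              deriv χ (ψ x) * fderiv ℝ ψ x (u x) := by
            rw [divergence, hUd, h1, divergence, Finset.mul_sum, Finset.mul_sum,
              ← Finset.sum_add_distrib]
            refine Finset.sum_congr rfl fun i _ => ?_
            simp [mul_assoc]
          rw [h2, hdiv x hx hge, htan x hx hge]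
          simp
    · have hxK : x ∉ {x ∈ W | ψ x ≤ ε₂} := fun h => hx h.1
      have hn := hK.isClosed.isOpen_compl.mem_nhds hxK
      have hUx : U =ᶠ[𝓝 x] fun _ => 0 := by
        filter_upwards [hn] with y hy using hU_K y hy
      have hpx : p =ᶠ[𝓝 x] fun _ => 0 := by
        filter_upwards [hn] with y hy using hp_K y hy
      obtain ⟨h1, h2, h3⟩ := htriv hUx
      refine ⟨h1, contDiffAt_const.congr_of_eventuallyEq hpx, ?_, h3⟩
      rw [h2, gradient_congr hpx]
      simp [gradient]
  refine ⟨U, p, ⟨contDiff_iff_contDiffAt.2 fun x => (hall x).1,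
    contDiff_iff_contDiffAt.2 fun x => (hall x).2.1, fun x => (hall x).2.2.1,
    fun x => (hall x).2.2.2⟩, .intro hK hU_K, .intro hK hp_K, fun h => hu₀ ?_⟩
  have h1 : U x₀ = 0 := congr_fun h x₀
  have h2 : χ ((ε₁ + ε₂) / 2) = 1 := χ.one_of_mem_closedBall (Metric.mem_closedBall_self χ.rIn_pos.le)
  simpa [U, hx₀, hψ₀, h2] using h1

end Localization

/-! ### The axisymmetric flow in three dimensions. -/

section Axisymmetric

variable {δ : ℝ} {k j B : ℝ → ℝ} {U : Set (ℝ × ℝ)} {ψ v : ℝ × ℝ → ℝ}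

/-- The map `x ↦ (r² / 2, z)` to the meridian half-plane. -/
def meridian (x : EuclideanSpace ℝ (Fin 3)) : ℝ × ℝ := ((x 0 ^ 2 + x 1 ^ 2) / 2, x 2)

/-- The `i`-th coordinate on `ℝ³` as a continuous linear functional. -/
def coordCLM (i : Fin 3) : EuclideanSpace ℝ (Fin 3) →L[ℝ] ℝ := EuclideanSpace.proj i

theorem coordCLM_apply (i : Fin 3) (x : EuclideanSpace ℝ (Fin 3)) : coordCLM i x = x i := rfl

theorem hasFDerivAt_coord (i : Fin 3) (x : EuclideanSpace ℝ (Fin 3)) :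
    HasFDerivAt (fun y : EuclideanSpace ℝ (Fin 3) => y i) (coordCLM i) x :=
  (coordCLM i).hasFDerivAt

theorem contDiff_meridian : ContDiff ℝ ∞ meridian := by
  unfold meridian
  fun_prop

theorem hasFDerivAt_meridian (x : EuclideanSpace ℝ (Fin 3)) :
    HasFDerivAt meridian ((x 0 • coordCLM 0 + x 1 • coordCLM 1).prod (coordCLM 2)) x := by
  refine HasFDerivAt.prodMk ?_ (hasFDerivAt_coord 2 x)
  have h := (((hasFDerivAt_coord 0 x).pow 2).add ((hasFDerivAt_coord 1 x).pow 2)).mul_const (1 / 2)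
  refine (h.congr_of_eventuallyEq (.of_forall fun y => ?_)).congr_fderiv ?_
  · simp [div_eq_mul_inv]
  · ext y
    simp
    ring

/-- The swirl `r u_φ` as a function of the value of the stream function. -/
def swirl (k B : ℝ → ℝ) (s : ℝ) : ℝ := √(-(3 * B s + 6 * s * k s))

/-- By `B j = s`, multiplying by `j > 0` gives `-3 s (2 k j + 1)`, whose sign is controlled by
`swirl_pos`. -/
theorem LevelProfile.swirl_arg_pos (h : LevelProfile δ k j B) {s : ℝ} (hs : s ∈ Metric.ball 0 δ)
    (h0 : 0 < s) : 0 < -(3 * B s + 6 * s * k s) := by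
  have h1 := h.j_pos s hs
  have h2 : -(3 * B s + 6 * s * k s) * j s = 3 * s * -(2 * k s * j s + 1) := by
    linear_combination -3 * h.B_mul s hs
  refine pos_of_mul_pos_left ?_ h1.le
  rw [h2]
  have := h.swirl_pos s hs
  exact mul_pos (by linarith) (by linarith)

theorem LevelProfile.contDiffAt_swirl (h : LevelProfile δ k j B) {s : ℝ}
    (hs : s ∈ Metric.ball 0 δ) (h0 : 0 < s) : ContDiffAt ℝ ∞ (swirl k B) s := by
  have hn := Metric.isOpen_ball.mem_nhds hs
  have hk := h.contDiffOn_k.contDiffAt hn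
  have hB := h.contDiffOn_B.contDiffAt hn
  exact ContDiffAt.sqrt (((contDiffAt_const.mul hB).add
    ((contDiffAt_const.mul contDiffAt_id).mul hk)).neg) (h.swirl_arg_pos hs h0).ne'

theorem LevelProfile.swirl_sq (h : LevelProfile δ k j B) {s : ℝ} (hs : s ∈ Metric.ball 0 δ)
    (h0 : 0 < s) : swirl k B s ^ 2 = -(3 * B s + 6 * s * k s) :=
  Real.sq_sqrt (h.swirl_arg_pos hs h0).le

/-- The axisymmetric velocity field with stream function `ψ` and swirl `swirl k B ∘ ψ`. -/
def axisymmetricVelocity (k B : ℝ → ℝ) (ψ v : ℝ × ℝ → ℝ) (x : EuclideanSpace ℝ (Fin 3)) :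
    EuclideanSpace ℝ (Fin 3) :=
  !₂[(v (meridian x) * x 0 - swirl k B (ψ (meridian x)) * x 1) * (2 * (meridian x).1)⁻¹,
    (v (meridian x) * x 1 + swirl k B (ψ (meridian x)) * x 0) * (2 * (meridian x).1)⁻¹,
    -((meridian x).1 + k (ψ (meridian x)))]

namespace IsStreamFunction

theorem contDiffOn (h : LevelProfile δ k j B) (H : IsStreamFunction δ k j B U ψ v) :
    ContDiffOn ℝ ∞ ψ U := contDiff_fst.comp_contDiffOn (H.contDiffOn_prodMk h)

theorem contDiffAt_velocity (h : LevelProfile δ k j B) (H : IsStreamFunction δ k j B U ψ v)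
    {x : EuclideanSpace ℝ (Fin 3)} (hx : meridian x ∈ U) (hpos : 0 < ψ (meridian x)) :
    ContDiffAt ℝ ∞ (axisymmetricVelocity k B ψ v) x := by
  have hU := H.isOpen.mem_nhds hx
  have hm := contDiff_meridian.contDiffAt (x := x)
  have hψ : ContDiffAt ℝ ∞ (fun y => ψ (meridian y)) x :=
    ContDiffAt.comp x (g := ψ) ((H.contDiffOn h).contDiffAt hU) hm
  have hv : ContDiffAt ℝ ∞ (fun y => v (meridian y)) x :=
    ContDiffAt.comp x (g := v)
      ((contDiff_snd.comp_contDiffOn (H.contDiffOn_prodMk h)).contDiffAt hU) hm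
  have hs := H.mem_ball _ hx
  have hF : ContDiffAt ℝ ∞ (fun y => swirl k B (ψ (meridian y))) x :=
    ContDiffAt.comp x (g := swirl k B) (h.contDiffAt_swirl hs hpos) hψ
  have hk : ContDiffAt ℝ ∞ (fun y => k (ψ (meridian y))) x :=
    ContDiffAt.comp x (g := k) (h.contDiffOn_k.contDiffAt (Metric.isOpen_ball.mem_nhds hs)) hψ
  have hτ : ContDiffAt ℝ ∞ (fun y => (2 * (meridian y).1)⁻¹) x :=
    (contDiffAt_const.mul (contDiffAt_fst.comp x hm)).inv (by have := H.rho_pos _ hx; positivity)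
  have hc (i : Fin 3) : ContDiffAt ℝ ∞ (fun y : EuclideanSpace ℝ (Fin 3) => y i) x :=
    (coordCLM i).contDiff.contDiffAt
  rw [contDiffAt_euclidean]
  intro i
  fin_cases i
  · exact ((hv.mul (hc 0)).sub (hF.mul (hc 1))).mul hτ
  · exact ((hv.mul (hc 1)).add (hF.mul (hc 0))).mul hτ
  · exact ((contDiffAt_fst.comp x hm).add hk).neg

theorem hasFDerivAt_comp_meridian (H : IsStreamFunction δ k j B U ψ v)
    {x : EuclideanSpace ℝ (Fin 3)} (hx : meridian x ∈ U) :
    HasFDerivAt (fun y => ψ (meridian y))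
      (((meridian x).1 + k (ψ (meridian x))) • (x 0 • coordCLM 0 + x 1 • coordCLM 1) +
        v (meridian x) • coordCLM 2) x := by
  refine (HasFDerivAt.comp x (g := ψ) (H.hasFDerivAt _ hx) (hasFDerivAt_meridian x)).congr_fderiv ?_
  ext y
  simp

theorem euler_velocity (h : LevelProfile δ k j B) (H : IsStreamFunction δ k j B U ψ v)
    {x : EuclideanSpace ℝ (Fin 3)} (hx : meridian x ∈ U) (hpos : 0 < ψ (meridian x)) :
    divergence (axisymmetricVelocity k B ψ v) x = 0 ∧
    advection (axisymmetricVelocity k B ψ v) x + gradient (fun y => ψ (meridian y)) x = 0 ∧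
    fderiv ℝ (fun y => ψ (meridian y)) x (axisymmetricVelocity k B ψ v x) = 0 := by
  have hs := H.mem_ball _ hx
  have hρ := H.rho_pos _ hx
  have hsq := H.axial_sq _ hx
  have hFsq := h.swirl_sq hs hpos
  have hcompat := h.compatibility (meridian x).1 hs
  have hψ := H.hasFDerivAt_comp_meridian hx
  have hv : HasFDerivAt (fun y => v (meridian y))
      ((v (meridian x) * j (ψ (meridian x))) • (x 0 • coordCLM 0 + x 1 • coordCLM 1) +
        (axialSqDeriv k j (meridian x).1 (ψ (meridian x)) / 2) • coordCLM 2) x := by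
    refine (HasFDerivAt.comp x (g := v) (H.hasFDerivAt_axial _ hx)
      (hasFDerivAt_meridian x)).congr_fderiv ?_
    ext y
    simp
  have hF := ((h.contDiffAt_swirl hs hpos).differentiableAt (by simp)).hasDerivAt.comp_hasFDerivAt
    x hψ
  have hk := (h.deriv_k _ hs).comp_hasFDerivAt x hψ
  have hr : HasFDerivAt (fun y => (meridian y).1) (x 0 • coordCLM 0 + x 1 • coordCLM 1) x :=
    (hasFDerivAt_meridian x).fst
  have hτ := (hasDerivAt_inv (show 2 * (meridian x).1 ≠ 0 by positivity)).comp_hasFDerivAt x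
    (hr.const_mul 2)
  have h0 := hasFDerivAt_coord 0 x
  have h1 := hasFDerivAt_coord 1 x
  have hu0 := ((hv.mul h0).sub (hF.mul h1)).mul hτ
  have hu1 := ((hv.mul h1).add (hF.mul h0)).mul hτ
  have hu2 := (hr.add hk).neg
  have hd := (H.contDiffAt_velocity h hx hpos).differentiableAt (by simp)
  have hcomp (i : Fin 3) (y : EuclideanSpace ℝ (Fin 3)) :
      fderiv ℝ (axisymmetricVelocity k B ψ v) x y i =
        fderiv ℝ (fun z => axisymmetricVelocity k B ψ v z i) x y :=
    (DFunLike.congr_fun ((coordCLM i).hasFDerivAt.comp x hd.hasFDerivAt).fderiv y).symm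
  have hgrad (i : Fin 3) := (gradient_apply x i).trans
    (DFunLike.congr_fun hψ.fderiv (EuclideanSpace.single i 1))
  have hmer : (meridian x).1 = (x 0 ^ 2 + x 1 ^ 2) / 2 := rfl
  have hτρ : (2 * (meridian x).1)⁻¹ * (x 0 ^ 2 + x 1 ^ 2) = 1 := by
    rw [show x 0 ^ 2 + x 1 ^ 2 = 2 * (meridian x).1 by rw [hmer]; ring]
    exact inv_mul_cancel₀ (by positivity)
  set s := ψ (meridian x)
  set V := v (meridian x)
  set ρ := (meridian x).1
  set F := swirl k B s
  set D := axialSqDeriv k j ρ s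
  set τ := (2 * ρ)⁻¹ with hτdef
  have e0 (y : EuclideanSpace ℝ (Fin 3)) : fderiv ℝ (axisymmetricVelocity k B ψ v) x y 0 =
      (V * x 0 - F * x 1) * (-2 * τ ^ 2 * (x 0 * y 0 + x 1 * y 1)) +
      τ * (V * y 0 + x 0 * (V * j s * (x 0 * y 0 + x 1 * y 1) + D / 2 * y 2) - (F * y 1 +
        x 1 * (deriv (swirl k B) s * ((ρ + k s) * (x 0 * y 0 + x 1 * y 1) + V * y 2)))) := by
    refine ((hcomp 0 y).trans (DFunLike.congr_fun hu0.fderiv y)).trans ?_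
    simp [coordCLM_apply, s, V, ρ, F, D, τ]
    ring
  have e1 (y : EuclideanSpace ℝ (Fin 3)) : fderiv ℝ (axisymmetricVelocity k B ψ v) x y 1 =
      (V * x 1 + F * x 0) * (-2 * τ ^ 2 * (x 0 * y 0 + x 1 * y 1)) +
      τ * (V * y 1 + x 1 * (V * j s * (x 0 * y 0 + x 1 * y 1) + D / 2 * y 2) + (F * y 0 +
        x 0 * (deriv (swirl k B) s * ((ρ + k s) * (x 0 * y 0 + x 1 * y 1) + V * y 2)))) := by
    refine ((hcomp 1 y).trans (DFunLike.congr_fun hu1.fderiv y)).trans ?_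
    simp [coordCLM_apply, s, V, ρ, F, D, τ]
    ring
  have e2 (y : EuclideanSpace ℝ (Fin 3)) : fderiv ℝ (axisymmetricVelocity k B ψ v) x y 2 =
      -(x 0 * y 0 + x 1 * y 1 + j s * ((ρ + k s) * (x 0 * y 0 + x 1 * y 1) + V * y 2)) := by
    refine ((hcomp 2 y).trans (DFunLike.congr_fun hu2.fderiv y)).trans ?_
    simp [coordCLM_apply, s, V, ρ]
    ring
  have u0 : axisymmetricVelocity k B ψ v x 0 = (V * x 0 - F * x 1) * τ := rfl
  have u1 : axisymmetricVelocity k B ψ v x 1 = (V * x 1 + F * x 0) * τ := rfl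
  have u2 : axisymmetricVelocity k B ψ v x 2 = -(ρ + k s) := rfl
  have hrad : x 0 * axisymmetricVelocity k B ψ v x 0 + x 1 * axisymmetricVelocity k B ψ v x 1 =
      V := by
    rw [u0, u1]
    linear_combination V * hτρ
  -- This is `|u|² = 3 ψ`; the swirl was chosen to cancel the terms of `G` that are free of an
  -- explicit factor `ρ`.
  have hkin : τ * (V ^ 2 + F ^ 2) = 3 * s - (ρ + k s) ^ 2 := by
    have h2ρ : τ * (2 * ρ) = 1 := inv_mul_cancel₀ (by positivity)
    rw [hsq, hFsq, axialSq]
    linear_combination (3 * s - (ρ + k s) ^ 2) * h2ρ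
  refine ⟨?_, ?_, ?_⟩
  · rw [divergence, Fin.sum_univ_three, e0, e1, e2]
    simp
    linear_combination (V * j s - 2 * τ * V) * hτρ
  · ext i
    rw [PiLp.add_apply, advection]
    fin_cases i
    · change fderiv ℝ (axisymmetricVelocity k B ψ v) x (axisymmetricVelocity k B ψ v x) 0 +
        gradient (fun y => ψ (meridian y)) x 0 = 0
      -- The unknown derivative of the swirl multiplies `u · ∇ψ = 0` and drops out. The radial
      -- balance then follows from `compatibility` and `|u|² = 3 ψ`.
      rw [e0, hgrad, hrad, u0, u1, u2]
      simp [coordCLM_apply]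
      have h2ρ : τ * (2 * ρ) = 1 := inv_mul_cancel₀ (by positivity)
      linear_combination τ * x 0 * j s * hsq - τ / 2 * x 0 * hcompat - τ * x 0 * hkin
        - x 0 * (ρ + k s) * h2ρ
    · change fderiv ℝ (axisymmetricVelocity k B ψ v) x (axisymmetricVelocity k B ψ v x) 1 +
        gradient (fun y => ψ (meridian y)) x 1 = 0
      rw [e1, hgrad, hrad, u0, u1, u2]
      simp [coordCLM_apply]
      have h2ρ : τ * (2 * ρ) = 1 := inv_mul_cancel₀ (by positivity)
      linear_combination τ * x 1 * j s * hsq - τ / 2 * x 1 * hcompat - τ * x 1 * hkin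
        - x 1 * (ρ + k s) * h2ρ
    · change fderiv ℝ (axisymmetricVelocity k B ψ v) x (axisymmetricVelocity k B ψ v x) 2 +
        gradient (fun y => ψ (meridian y)) x 2 = 0
      rw [e2, hgrad, hrad, u2]
      simp [coordCLM_apply]
      exact Or.inr (by ring)
  · rw [hψ.fderiv]
    simp only [add_apply, smul_apply, coordCLM_apply, smul_eq_mul, hrad, u2]
    ring

/-- The minimum of `ψ` over a small compact sphere is positive, as `ψ` vanishes only at the centre.
-/
theorem exists_level (h : LevelProfile δ k j B) (H : IsStreamFunction δ k j B U ψ v) :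
    ∃ R μ : ℝ, 0 < R ∧ 0 < μ ∧ Metric.closedBall (3 / 4, 0) R ⊆ U ∧
      ∀ p ∈ Metric.sphere ((3 / 4, 0) : ℝ × ℝ) R, μ ≤ ψ p := by
  obtain ⟨R, hR, hRU⟩ := Metric.nhds_basis_closedBall.mem_iff.1 (H.isOpen.mem_nhds H.mem)
  have hsub : Metric.sphere ((3 / 4, 0) : ℝ × ℝ) R ⊆ U := Metric.sphere_subset_closedBall.trans hRU
  obtain ⟨q, hq, hmin⟩ := (isCompact_sphere ((3 / 4, 0) : ℝ × ℝ) R).exists_isMinOn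
    (NormedSpace.sphere_nonempty.2 hR.le) ((H.contDiffOn h).continuousOn.mono hsub)
  refine ⟨R, ψ q, hR, (H.nonneg q (hsub hq)).lt_of_ne fun h0 => ?_, hRU, hmin⟩
  rw [H.eq_of_zero q (hsub hq) h0.symm, Metric.mem_sphere, dist_self] at hq
  exact hR.ne hq

theorem isCompact_sublevel (h : LevelProfile δ k j B) (H : IsStreamFunction δ k j B U ψ v)
    {R μ ε : ℝ} (hRU : Metric.closedBall (3 / 4, 0) R ⊆ U)
    (hμ : ∀ p ∈ Metric.sphere ((3 / 4, 0) : ℝ × ℝ) R, μ ≤ ψ p) (hε : ε < μ) :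
    IsCompact {x | x ∈ meridian ⁻¹' Metric.ball (3 / 4, 0) R ∧ ψ (meridian x) ≤ ε} := by
  have heq : {x | x ∈ meridian ⁻¹' Metric.ball (3 / 4, 0) R ∧ ψ (meridian x) ≤ ε} =
      meridian ⁻¹' (Metric.closedBall (3 / 4, 0) R ∩ ψ ⁻¹' Iic ε) := by
    ext x
    refine ⟨fun hx => ⟨Metric.ball_subset_closedBall hx.1, hx.2⟩, fun hx => ⟨?_, hx.2⟩⟩
    -- On the sphere `ψ ≥ μ > ε`, so open and closed balls give the same sublevel set.
    refine (Metric.mem_closedBall.1 hx.1).lt_of_ne fun hs => ?_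
    have h1 := hμ _ hs
    have h2 : ψ (meridian x) ≤ ε := hx.2
    linarith
  rw [heq]
  have hclosed : IsClosed (Metric.closedBall (3 / 4, 0) R ∩ ψ ⁻¹' Iic ε) :=
    ((H.contDiffOn h).continuousOn.mono hRU).preimage_isClosed_of_isClosed
      Metric.isClosed_closedBall isClosed_Iic
  refine Metric.isCompact_of_isClosed_isBounded
    (hclosed.preimage contDiff_meridian.continuous) ?_
  -- The radius comes from `|x|² = 2 ρ + z²`.
  refine (Metric.isBounded_iff_subset_closedBall 0).2 ⟨√(2 * (3 / 4 + R) + R ^ 2), fun x hx => ?_⟩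
  have h1 := Metric.mem_closedBall.1 hx.1
  rw [Prod.dist_eq, max_le_iff, Real.dist_eq, Real.dist_eq] at h1
  simp only [meridian, sub_zero] at h1
  have h2 := (abs_le.1 h1.1).2
  have h3 := sq_le_sq' (abs_le.1 h1.2).1 (abs_le.1 h1.2).2
  rw [mem_closedBall_zero_iff, EuclideanSpace.norm_eq]
  refine Real.sqrt_le_sqrt ?_
  simp only [Fin.sum_univ_three, Real.norm_eq_abs, sq_abs]
  linarith

theorem exists_eq_level (h : LevelProfile δ k j B) (H : IsStreamFunction δ k j B U ψ v)
    {R μ m : ℝ} (hR : 0 < R) (hRU : Metric.closedBall (3 / 4, 0) R ⊆ U)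
    (hμ : ∀ p ∈ Metric.sphere ((3 / 4, 0) : ℝ × ℝ) R, μ ≤ ψ p) (hm : 0 < m) (hmμ : m < μ) :
    ∃ ρ : ℝ, 0 < ρ ∧ ((ρ, 0) : ℝ × ℝ) ∈ Metric.ball (3 / 4, 0) R ∧ ψ (ρ, 0) = m := by
  have hdist (t : ℝ) : dist ((3 / 4 + t, 0) : ℝ × ℝ) (3 / 4, 0) = |t| := by
    simp [Prod.dist_eq]
  have hmaps : MapsTo (fun t : ℝ => ((3 / 4 + t, 0) : ℝ × ℝ)) (Icc 0 R) U := fun t ht => by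
    refine hRU ?_
    rw [Metric.mem_closedBall, hdist, abs_of_nonneg ht.1]
    exact ht.2
  have hcont : ContinuousOn (fun t : ℝ => ψ (3 / 4 + t, 0)) (Icc 0 R) :=
    (H.contDiffOn h).continuousOn.comp (by fun_prop) hmaps
  have hend : μ ≤ ψ (3 / 4 + R, 0) := by
    refine hμ _ ?_
    rw [Metric.mem_sphere, hdist, abs_of_pos hR]
  obtain ⟨t, ht, htm⟩ := intermediate_value_Icc hR.le hcont
    (show m ∈ _ from ⟨by simpa [H.zero] using hm.le, hmμ.le.trans hend⟩)
  have htm' : ψ (3 / 4 + t, 0) = m := htm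
  refine ⟨3 / 4 + t, by linarith [ht.1], ?_, htm'⟩
  rw [Metric.mem_ball, hdist, abs_of_nonneg ht.1]
  refine ht.2.lt_of_ne fun h => ?_
  rw [h] at htm'
  linarith

end IsStreamFunction

theorem exists_euler_three :
    ∃ (u : EuclideanSpace ℝ (Fin 3) → EuclideanSpace ℝ (Fin 3))
      (p : EuclideanSpace ℝ (Fin 3) → ℝ),
      IsStationaryEuler u p ∧ HasCompactSupport u ∧ HasCompactSupport p ∧ u ≠ 0 := by
  obtain ⟨δ, k, j, B, hδ, h⟩ := exists_levelProfile
  obtain ⟨U, ψ, v, H⟩ := h.exists_streamFunction hδ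
  obtain ⟨R, μ, hR, hμ, hRU, hμψ⟩ := H.exists_level h
  obtain ⟨ρ, hρ, hball, hρψ⟩ := H.exists_eq_level h hR hRU hμψ (m := (μ / 4 + μ / 2) / 2)
    (by linarith) (by linarith)
  have hmem {x} (hx : x ∈ meridian ⁻¹' Metric.ball (3 / 4, 0) R) : meridian x ∈ U :=
    hRU (Metric.ball_subset_closedBall hx)
  have hpos {x} (hx : μ / 4 ≤ ψ (meridian x)) : 0 < ψ (meridian x) := by linarith
  have hx₀ : meridian !₂[√(2 * ρ), 0, 0] = (ρ, 0) := by
    have := Real.sq_sqrt (by positivity : 0 ≤ 2 * ρ)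
    ext <;> simp [meridian, -Real.sqrt_mul', -Real.sqrt_mul, -Nat.ofNat_nonneg, this]
  refine exists_compactSupport_euler (W := meridian ⁻¹' Metric.ball (3 / 4, 0) R)
    (u := axisymmetricVelocity k B ψ v) (ψ := fun x => ψ (meridian x)) (ε₁ := μ / 4) (ε₂ := μ / 2)
    (x₀ := !₂[√(2 * ρ), 0, 0]) (Metric.isOpen_ball.preimage contDiff_meridian.continuous)
    (by linarith)
    ((H.contDiffOn h).comp contDiff_meridian.contDiffOn fun x hx => hmem hx)
    (fun x hx hs => H.contDiffAt_velocity h (hmem hx) (hpos hs))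
    (fun x hx hs => (H.euler_velocity h (hmem hx) (hpos hs)).1)
    (fun x hx hs => (H.euler_velocity h (hmem hx) (hpos hs)).2.1)
    (fun x hx hs => (H.euler_velocity h (hmem hx) (hpos hs)).2.2)
    (H.isCompact_sublevel h hRU hμψ (by linarith)) ?_ ?_ fun h0 => ?_
  · rwa [mem_preimage, hx₀]
  · rw [hx₀, hρψ]
  -- At `x₀` this component is the swirl divided by `√(2 ρ)`, which is positive.
  · have h1 := congr_arg (fun y : EuclideanSpace ℝ (Fin 3) => y 1) h0
    have hs : ψ (ρ, 0) ∈ Metric.ball 0 δ :=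
      H.mem_ball _ (hRU (Metric.ball_subset_closedBall hball))
    have hF : 0 < swirl k B (ψ (ρ, 0)) :=
      Real.sqrt_pos.2 (h.swirl_arg_pos hs (by rw [hρψ]; linarith))
    simp only [axisymmetricVelocity, hx₀] at h1
    simp [hF.ne', hρ.ne'] at h1
    exact (Real.sqrt_pos.2 hρ).ne' h1

end Axisymmetric

end

theorem proposition2p1 :
    (∀ d : ℕ, (d = 3 ∨ (Even d ∧ 2 ≤ d)) →
      ∃ (u : EuclideanSpace ℝ (Fin d) → EuclideanSpace ℝ (Fin d))
        (p : EuclideanSpace ℝ (Fin d) → ℝ),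
        IsStationaryEuler u p ∧ HasCompactSupport u ∧ HasCompactSupport p ∧ u ≠ 0) ∧
    (∀ (d : ℕ) (hd : Even d), 2 ≤ d →
      ∀ f : ℝ → ℝ, ContDiff ℝ ∞ f → HasCompactSupport f → (∀ r, f (-r) = f r) →
        IsStationaryEuler (radialVelocity hd f) (radialPressure f) ∧
        HasCompactSupport (radialVelocity hd f) ∧
        (f ≠ 0 → radialVelocity hd f ≠ 0)) := by
  refine ⟨?_, fun d hd h2 f hf hc he => ⟨isStationaryEuler_radial hd hf he,
    hasCompactSupport_radialVelocity hd hc, radialVelocity_ne_zero hd h2 hf.continuous he⟩⟩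
  rintro d (rfl | ⟨hd, h2⟩)
  · exact exists_euler_three
  · exact exists_euler_of_even hd h2
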